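/- All manifolds are smooth, finite-dimensional, Hausdorff, second countable and without boundary, and all Lie groups are real Lie groups of this kind. Actions are smooth and written on the left (a right action $pg$ is the left action $g^{-1}p$). An action is called *principal* if it is free and proper; an action of a topological group $H$ on a topological space $X$ is called *pre-principal* if the induced action of $H/\ker$ on $X$ is free and proper, where $\ker$ is the subgroup of elements acting as the identity. Let $P$ be a non-empty manifold with principal actions $\rho,\rho'$ of Lie groups $G,G'$. Let $(P\times P)/G$ be the gauge groupoid over $P/G$, i.e. the space of orbits $\langle p,q\rangle$ of the diagonal action of $G$ with multiplication $\langle p,q\rangle\langle q,r\rangle=\langle p,r\rangle$. The action $\rho'$ is called $(P,G)$-*principal* if $g'\langle p,q\rangle=\langle g'p,g'q\rangle$ is a well-defined action of $G'$ on $(P\times P)/G$ by groupoid automorphisms and this action is pre-principal. Assume that $P$ is a *double principal bundle*, i.e. that $\rho'$ is $(P,G)$-principal and $\rho$ is $(P,G')$-principal. **Theorem.** The group $\widehat G$ of transformations of $P$ generated by $\{\rho_g\}_{g\in G}$ and $\{\rho'_{g'}\}_{g'\in G'}$ equals $\{\rho_g\circ\rho'_{g'} : g\in G,\ g'\in G'\}$.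 It carries a canonical Lie group structure (the one for which $G\times G'\to\widehat G$, $(g,g')\mapsto\rho_g\circ\rho'_{g'}$, is a submersion), and $g\mapsto\rho_g$, $g'\mapsto\rho'_{g'}$ identify $G$ and $G'$ with closed normal Lie subgroups of $\widehat G$. Put $G_0=G\cap G'$ (intersection in $\widehat G$); it is normal in $G$ and in $G'$, and $[G]=G/G_0$, $[G']=G'/G_0$ are Lie groups for which the quotient maps are submersions. The orbit spaces $M=P/G$, $M'=P/G'$ and $M_0=P/\widehat G$, with their quotient topologies, have manifold structures for which the projections $\pi:P\to M$, $\pi':P\to M'$ and $P\to M_0$ are submersions, and these are principal bundles with structure groups $G$, $G'$ and $\widehat G$; in particular the action of $\widehat G$ on $P$ is principal. The formulas $[g]\,\pi'(p)=\pi'(gp)$ and $[g']\,\pi(p)=\pi(g'p)$ define principal actions of $[G]$ on $M'$ and of $[G']$ on $M$, and the canonical maps $[\pi]:M'\to M_0$ and $[\pi']:M\to M_0$ are principal bundles with structure groups $[G]$ and $[G']$. The square $$\begin{array}{ccc} P & \xrightarrow{\ \pi'\ } & M'\\ {\scriptstyle\pi}\downarrow & & \downarrow{\scriptstyle[\pi]}\\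 M & \xrightarrow{\ [\pi']\ } & M_0\end{array}$$ commutes; its horizontal maps $(\pi',[\pi'])$ form a morphism from the $G$-principal bundle $\pi$ to the $[G]$-principal bundle $[\pi]$ over the homomorphism $G\to[G]$, and its vertical maps $(\pi,[\pi])$ form a morphism from the $G'$-principal bundle $\pi'$ to the $[G']$-principal bundle $[\pi']$ over $G'\to[G']$. -/

import Mathlib

open scoped Manifold ContDiff

namespace DoublePrincipal

/-! Manifolds are finite-dimensional, Hausdorff, second countable, without boundary and smooth,
modelled on `EuclideanSpace ℝ (Fin n)`. Actions are written on the left; a right action `p g` is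
the left action `g⁻¹ • p`. The orbit space `P/G` is `MulAction.orbitRel.Quotient G P` with the
quotient topology. -/

/-- A (Hausdorff, second countable) smooth manifold of dimension `n`. -/
structure IsSmoothManifold (n : ℕ) (M : Type*) [TopologicalSpace M]
    [ChartedSpace (EuclideanSpace ℝ (Fin n)) M] : Prop where
  isManifold : IsManifold (𝓡 n) ∞ M
  t2 : T2Space M
  secondCountable : SecondCountableTopology M

/-- A (Hausdorff, second countable) Lie group of dimension `n`. -/
structure IsLie (n : ℕ) (G : Type*) [Group G] [TopologicalSpace G]
    [ChartedSpace (EuclideanSpace ℝ (Fin n)) G] : Prop where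
  lieGroup : LieGroup (𝓡 n) ∞ G
  t2 : T2Space G
  secondCountable : SecondCountableTopology G

/-- A principal action: free and proper. -/
structure IsPrincipalAction (G X : Type*) [Group G] [TopologicalSpace G] [TopologicalSpace X]
    [MulAction G X] : Prop where
  free : ∀ (g : G) (x : X), g • x = x → g = 1
  proper : ProperSMul G X

/-- The action of `G / ker` induced by an action of `G` on `X`, where `ker` is the group of those
`g` that act as the identity. -/
@[reducible] def effectiveAction (G X : Type*) [Group G] [MulAction G X] :
    MulAction (G ⧸ (MulAction.toPermHom G X).ker) X :=
  MulAction.compHom X (QuotientGroup.kerLift (MulAction.toPermHom G X))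

/-- A pre-principal action: the induced action of `G / ker` is principal. -/
def IsPrePrincipalAction (G X : Type*) [Group G] [TopologicalSpace G] [TopologicalSpace X]
    [MulAction G X] : Prop :=
  letI := effectiveAction G X
  IsPrincipalAction (G ⧸ (MulAction.toPermHom G X).ker) X

/-- The projection of `X` onto its orbit space `X/G`. -/
def proj (G : Type*) {X : Type*} [Group G] [MulAction G X] (x : X) :
    MulAction.orbitRel.Quotient G X :=
  Quotient.mk'' x

section Gauge

variable (G P : Type*) [Group G] [MulAction G P]

/-- The gauge groupoid `(P × P)/G` over `P/G` (orbits of the diagonal action). -/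
abbrev Gauge : Type _ := MulAction.orbitRel.Quotient G (P × P)

variable {G P}

/-- The target map `⟨p, q⟩ ↦ [p]`. -/
def Gauge.target : Gauge G P → MulAction.orbitRel.Quotient G P :=
  Quotient.map' Prod.fst (by rintro _ _ ⟨g, rfl⟩; exact ⟨g, rfl⟩)

/-- The source map `⟨p, q⟩ ↦ [q]`. -/
def Gauge.source : Gauge G P → MulAction.orbitRel.Quotient G P :=
  Quotient.map' Prod.snd (by rintro _ _ ⟨g, rfl⟩; exact ⟨g, rfl⟩)

/-- The graph of the partial multiplication: `a b = c`, where `⟨p, q⟩ ⟨q, r⟩ = ⟨p, r⟩`. -/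
def Gauge.IsMul (a b c : Gauge G P) : Prop :=
  ∃ p q r : P, a = proj G (p, q) ∧ b = proj G (q, r) ∧ c = proj G (p, r)

/-- `Φ` is an automorphism of the gauge groupoid (over some bijection `φ` of the units). -/
structure Gauge.IsAut (Φ : Gauge G P → Gauge G P) : Prop where
  bijective : Function.Bijective Φ
  base : ∃ φ : Equiv.Perm (MulAction.orbitRel.Quotient G P), ∀ a,
    source (Φ a) = φ (source a) ∧ target (Φ a) = φ (target a)
  mul : ∀ a b c, IsMul a b c → IsMul (Φ a) (Φ b) (Φ c)

end Gauge

/-- The action of `G'` on `P` is `(P, G)`-principal: the formula `g' ⟨p, q⟩ = ⟨g' p, g' q⟩` gives a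
well-defined action of `G'` on the gauge groupoid `(P × P)/G`, by groupoid automorphisms, and this
action is pre-principal. (Smoothness of the induced action is automatic, so it is not required.) -/
def IsRelPrincipal (G G' P : Type*) [Group G] [Group G'] [TopologicalSpace G']
    [TopologicalSpace P] [MulAction G P] [MulAction G' P] : Prop :=
  ∃ _ : MulAction G' (Gauge G P),
    (∀ (g' : G') (p q : P),
      g' • (proj G (p, q) : Gauge G P) = proj G (g' • p, g' • q)) ∧
    (∀ g' : G', Gauge.IsAut (fun a : Gauge G P => g' • a)) ∧
    IsPrePrincipalAction G' (Gauge G P)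

/-- `P` is a double principal bundle for the given (smooth) actions of `G` and `G'`. -/
structure IsDoublePrincipalBundle (G G' P : Type*) [Group G] [Group G'] [TopologicalSpace G]
    [TopologicalSpace G'] [TopologicalSpace P] [MulAction G P] [MulAction G' P] : Prop where
  left : IsPrincipalAction G P
  right : IsPrincipalAction G' P
  right_rel : IsRelPrincipal G G' P
  left_rel : IsRelPrincipal G' G P

section StructureGroup

variable (G G' P : Type*) [Group G] [Group G'] [MulAction G P] [MulAction G' P]

/-- The group of transformations of `P` generated by the two actions. -/
def structureGroup : Subgroup (Equiv.Perm P) :=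
  (MulAction.toPermHom G P).range ⊔ (MulAction.toPermHom G' P).range

/-- The map `G → Ĝ`. -/
def inclLeft : G →* structureGroup G G' P :=
  (MulAction.toPermHom G P).codRestrict _
    fun g => (le_sup_left : _ ≤ structureGroup G G' P) ⟨g, rfl⟩

/-- The map `G' → Ĝ`. -/
def inclRight : G' →* structureGroup G G' P :=
  (MulAction.toPermHom G' P).codRestrict _
    fun g => (le_sup_right : _ ≤ structureGroup G G' P) ⟨g, rfl⟩

/-- `G₀ = G ∩ G'`, as a subgroup of `G`: those `g` acting on `P` as some element of `G'`. -/
def inter : Subgroup G :=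
  (MulAction.toPermHom G' P).range.comap (MulAction.toPermHom G P)

/-- The canonical map `P/G → P/Ĝ`. -/
def descLeft : MulAction.orbitRel.Quotient G P →
    MulAction.orbitRel.Quotient (structureGroup G G' P) P :=
  Quotient.map' id (by rintro _ _ ⟨g, rfl⟩; exact ⟨inclLeft G G' P g, rfl⟩)

/-- The canonical map `P/G' → P/Ĝ`. -/
def descRight : MulAction.orbitRel.Quotient G' P →
    MulAction.orbitRel.Quotient (structureGroup G G' P) P :=
  Quotient.map' id (by rintro _ _ ⟨g, rfl⟩; exact ⟨inclRight G G' P g, rfl⟩)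

end StructureGroup

/-- `π : P → M` is a (smooth) principal bundle with structure group `G`: the action of `G` on `P` is
smooth, free and proper, and `π` is a surjective submersion whose fibres are the orbits.
Here `m`, `n`, `b` are the dimensions of `G`, `P`, `M`. -/
structure IsPrincipalBundle (m n b : ℕ) (G : Type*) {P M : Type*} [Group G] [TopologicalSpace G]
    [ChartedSpace (EuclideanSpace ℝ (Fin m)) G] [TopologicalSpace P]
    [ChartedSpace (EuclideanSpace ℝ (Fin n)) P] [TopologicalSpace M]
    [ChartedSpace (EuclideanSpace ℝ (Fin b)) M] [MulAction G P] (π : P → M) : Prop where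
  group : IsLie m G
  total : IsSmoothManifold n P
  base : IsSmoothManifold b M
  smooth : ContMDiffSMul (𝓡 m) (𝓡 n) ∞ G P
  principal : IsPrincipalAction G P
  surjective : Function.Surjective π
  submersion : Manifold.IsSubmersion (𝓡 n) (𝓡 b) ∞ π
  fiber : ∀ p q : P, π p = π q ↔ ∃ g : G, g • p = q

/-- `(Φ, φ)` is a morphism from the principal bundle `π₁ : P₁ → M₁` with structure group `G₁` to the
principal bundle `π₂ : P₂ → M₂` with structure group `G₂`, over the homomorphism `χ : G₁ → G₂` of
Lie groups. -/
structure IsPrincipalBundleMorphism (m₁ n₁ b₁ m₂ n₂ b₂ : ℕ) {G₁ P₁ M₁ G₂ P₂ M₂ : Type*}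
    [Group G₁] [TopologicalSpace G₁] [ChartedSpace (EuclideanSpace ℝ (Fin m₁)) G₁]
    [TopologicalSpace P₁] [ChartedSpace (EuclideanSpace ℝ (Fin n₁)) P₁]
    [TopologicalSpace M₁] [ChartedSpace (EuclideanSpace ℝ (Fin b₁)) M₁]
    [Group G₂] [TopologicalSpace G₂] [ChartedSpace (EuclideanSpace ℝ (Fin m₂)) G₂]
    [TopologicalSpace P₂] [ChartedSpace (EuclideanSpace ℝ (Fin n₂)) P₂]
    [TopologicalSpace M₂] [ChartedSpace (EuclideanSpace ℝ (Fin b₂)) M₂]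
    [MulAction G₁ P₁] [MulAction G₂ P₂]
    (π₁ : P₁ → M₁) (π₂ : P₂ → M₂) (χ : G₁ →* G₂) (Φ : P₁ → P₂) (φ : M₁ → M₂) : Prop where
  source : IsPrincipalBundle m₁ n₁ b₁ G₁ π₁
  target : IsPrincipalBundle m₂ n₂ b₂ G₂ π₂
  smooth_hom : ContMDiff (𝓡 m₁) (𝓡 m₂) ∞ χ
  smooth_total : ContMDiff (𝓡 n₁) (𝓡 n₂) ∞ Φ
  smooth_base : ContMDiff (𝓡 b₁) (𝓡 b₂) ∞ φ
  equivariant : ∀ (g : G₁) (p : P₁), Φ (g • p) = χ g • Φ p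
  comm : ∀ p : P₁, π₂ (Φ p) = φ (π₁ p)

/-- The homomorphism `χ` identifies the Lie group `G` (of dimension `m`) with a closed normal Lie
subgroup of the Lie group `K` (of dimension `k`). -/
structure IsClosedNormalLieSubgroup (m k : ℕ) {G K : Type*} [Group G] [TopologicalSpace G]
    [ChartedSpace (EuclideanSpace ℝ (Fin m)) G] [Group K] [TopologicalSpace K]
    [ChartedSpace (EuclideanSpace ℝ (Fin k)) K] (χ : G →* K) : Prop where
  embedding : Manifold.IsSmoothEmbedding (𝓡 m) (𝓡 k) ∞ χ
  closed : IsClosed (χ.range : Set K)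
  normal : χ.range.Normal

end DoublePrincipal

open DoublePrincipal

open DoublePrincipal

/-! The algebra comes from the gauge groupoid. Since `g'` respects the `G`-orbits in `P × P`, for
each `g` the pairs `(g' p₀, g' p)` and `(g' g p₀, g' g p)` differ by some `k` in `G`. Freeness at
`g' p₀` makes `k` independent of `p`, so `g' g = k g'` on `P` (`IsRelPrincipal.exists_conj`): `G'`
normalizes `G`, and products of the two groups already form a group. The same argument shows that
the kernel of `G'` on the groupoid is `G₀` (`ker_eq_inter`). If `g p = g' p`, then `g'` fixes the
unit `⟨p, p⟩`, so pre-principality puts `g'` in `G₀`; hence both `[G']` on `M` and `Ĝ` on `P` act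
freely.

Properness of `[G']` on `M` is inherited from the groupoid, because the units form a closed
invariant copy of `M` (`exists_isClosedEmbedding_gauge`). Properness of `Ĝ` on `P` is assembled in
two stages: the class of the `G'`-factor converges in `[G']`, a local section lifts it to `G'`, and
properness of `G` controls the remaining factor (`properSMul_structureGroup`).

Every manifold structure arises from one principle (`exists_chartedSpace_of_slices`): a quotient map
has a smooth structure if its fibres are homogeneous under smooth maps preserving them and it has
local slices. For `P/G`, `P/G'` and `P/Ĝ` the slices are transversals to the orbits, cut down by
properness (`exists_slice_of_isPrincipalAction`). For `[G]`, `[G']` and `Ĝ` the quotient has the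
same fibres as an orbit map, which has constant rank by equivariance, and the constant rank theorem
gives slices (`IsHomogeneousMap.exists_chartedSpace`). The resulting projections have smooth local
sections through all points, so the group operations, the actions and the maps to `M₀` descend
smoothly. -/

section

open Set
open scoped Topology

/-! ### Linear algebra, inverse function theorem and constant rank in vector spaces. -/

/-- A linear map completing a surjective linear map to an isomorphism. -/
lemma exists_complement_of_surjective {E E' : Type*} [NormedAddCommGroup E] [NormedSpace ℝ E]
    [FiniteDimensional ℝ E] [NormedAddCommGroup E'] [NormedSpace ℝ E'] [FiniteDimensional ℝ E']
    (A : E →L[ℝ] E') (hA : Function.Surjective A) {d : ℕ}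
    (hd : Module.finrank ℝ E = Module.finrank ℝ E' + d) :
    ∃ B : E →L[ℝ] EuclideanSpace ℝ (Fin d), Function.Bijective (A.prod B) := by
  obtain ⟨pr, hpr⟩ := A.ker.subtype.exists_leftInverse_of_injective (by simp)
  have hker : Module.finrank ℝ A.ker = d := by
    have h1 := LinearMap.finrank_range_add_finrank_ker (A : E →ₗ[ℝ] E')
    rw [LinearMap.range_eq_top.2 hA, finrank_top] at h1
    have h2 : Module.finrank ℝ (LinearMap.ker (A : E →ₗ[ℝ] E')) = Module.finrank ℝ A.ker := rfl
    omega
  let ι : A.ker ≃ₗ[ℝ] EuclideanSpace ℝ (Fin d) :=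
    LinearEquiv.ofFinrankEq _ _ (by simp [hker])
  let B : E →ₗ[ℝ] EuclideanSpace ℝ (Fin d) := ι.toLinearMap ∘ₗ pr
  refine ⟨LinearMap.toContinuousLinearMap B, ?_⟩
  have hinj : Function.Injective (A.prod (LinearMap.toContinuousLinearMap B)) := by
    rw [injective_iff_map_eq_zero]
    intro x hx
    have hx1 : A x = 0 := congrArg Prod.fst hx
    have hx2 : ι (pr x) = 0 := congrArg Prod.snd hx
    have hx3 : pr x = 0 := by simpa using hx2
    have hx4 : pr (A.ker.subtype ⟨x, hx1⟩) = ⟨x, hx1⟩ := LinearMap.congr_fun hpr ⟨x, hx1⟩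
    exact congrArg Subtype.val (hx4.symm.trans hx3)
  refine ⟨hinj, ?_⟩
  exact (LinearMap.injective_iff_surjective_of_finrank_eq_finrank
    (f := (A.prod (LinearMap.toContinuousLinearMap B) : E →ₗ[ℝ] E' × EuclideanSpace ℝ (Fin d)))
    (by simp [hd])).1 hinj

/-- A linear map completing an injective linear map to an isomorphism. -/
lemma exists_complement_of_injective {E E' : Type*} [NormedAddCommGroup E] [NormedSpace ℝ E]
    [FiniteDimensional ℝ E] [NormedAddCommGroup E'] [NormedSpace ℝ E'] [FiniteDimensional ℝ E']
    (A : E →L[ℝ] E') (hA : Function.Injective A) {d : ℕ}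
    (hd : Module.finrank ℝ E' = Module.finrank ℝ E + d) :
    ∃ B : EuclideanSpace ℝ (Fin d) →L[ℝ] E', Function.Bijective (A.coprod B) := by
  obtain ⟨C, hC⟩ := A.range.exists_isCompl
  have hrk : Module.finrank ℝ C = d := by
    have h1 := LinearMap.finrank_range_of_inj (f := (A : E →ₗ[ℝ] E')) hA
    have h2 := Submodule.finrank_add_eq_of_isCompl hC
    have h3 : Module.finrank ℝ (LinearMap.range (A : E →ₗ[ℝ] E')) = Module.finrank ℝ A.range := rfl
    omega
  let ι : EuclideanSpace ℝ (Fin d) ≃ₗ[ℝ] C := LinearEquiv.ofFinrankEq _ _ (by simp [hrk])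
  let B : EuclideanSpace ℝ (Fin d) →ₗ[ℝ] E' := C.subtype ∘ₗ ι.toLinearMap
  refine ⟨LinearMap.toContinuousLinearMap B, ?_⟩
  have hinj : Function.Injective (A.coprod (LinearMap.toContinuousLinearMap B)) := by
    rw [injective_iff_map_eq_zero]
    rintro ⟨x, y⟩ hxy
    have h0 : A x + (ι y : E') = 0 := hxy
    have h1 : A x ∈ A.range ⊓ C := ⟨⟨x, rfl⟩, by
      rw [eq_neg_of_add_eq_zero_left h0]; exact C.neg_mem (ι y).2⟩
    rw [hC.inf_eq_bot, Submodule.mem_bot] at h1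
    have hx : x = 0 := hA (by rw [h1, map_zero])
    rw [h1, zero_add] at h0
    have hy : ι y = 0 := Subtype.ext h0
    simp only [hx, Prod.mk_eq_zero, true_and]
    simpa using hy
  refine ⟨hinj, ?_⟩
  exact (LinearMap.injective_iff_surjective_of_finrank_eq_finrank
    (f := (A.coprod (LinearMap.toContinuousLinearMap B) : E × EuclideanSpace ℝ (Fin d) →ₗ[ℝ] E'))
    (by simp [hd])).1 hinj

/-- The inverse function theorem, with smoothness of the inverse on its whole domain. -/
lemma exists_openPartialHomeomorph_of_bijective_fderiv {E F : Type*} [NormedAddCommGroup E]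
    [NormedSpace ℝ E] [CompleteSpace E] [NormedAddCommGroup F] [NormedSpace ℝ F] [CompleteSpace F]
    {f : E → F} {x : E} {U : Set E} (hU : U ∈ 𝓝 x) (hf : ContDiffOn ℝ ∞ f U)
    (hb : Function.Bijective (fderiv ℝ f x)) :
    ∃ e : OpenPartialHomeomorph E F, x ∈ e.source ∧ e.source ⊆ U ∧ (∀ y, e y = f y) ∧
      ContDiffOn ℝ ∞ e e.source ∧ ContDiffOn ℝ ∞ e.symm e.target := by
  have hat : ∀ y ∈ interior U, ContDiffAt ℝ ∞ f y := fun y hy =>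
    hf.contDiffAt (mem_interior_iff_mem_nhds.1 hy)
  have hx : x ∈ interior U := mem_interior_iff_mem_nhds.2 hU
  let A : E ≃L[ℝ] F := ContinuousLinearEquiv.ofBijective (fderiv ℝ f x)
    (LinearMap.ker_eq_bot.2 hb.1) (LinearMap.range_eq_top.2 hb.2)
  have hA : HasFDerivAt f (A : E →L[ℝ] F) x := by
    have := ((hat x hx).differentiableAt (by simp)).hasFDerivAt
    exact this
  let e₀ := (hat x hx).toOpenPartialHomeomorph f hA (by simp)
  have hcont : ContinuousOn (fderiv ℝ f) (interior U) :=
    (hf.mono interior_subset).continuousOn_fderiv_of_isOpen isOpen_interior (by simp)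
  -- Restricting to the open set where the derivative is invertible makes the inverse smooth on the
  -- whole target, not only at the image of `x`.
  let W : Set E := interior U ∩ (fderiv ℝ f) ⁻¹' (range ContinuousLinearEquiv.toContinuousLinearMap)
  have hW : IsOpen W := hcont.isOpen_inter_preimage isOpen_interior ContinuousLinearEquiv.isOpen
  have hxW : x ∈ W := ⟨hx, A, by rw [hA.fderiv]⟩
  have hsrc : (e₀.restr W).source = e₀.source ∩ W := by
    rw [OpenPartialHomeomorph.restr_source, hW.interior_eq]
  refine ⟨e₀.restr W, ?_, ?_, fun y => rfl, ?_, ?_⟩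
  · rw [hsrc]
    exact ⟨(hat x hx).mem_toOpenPartialHomeomorph_source hA (by simp), hxW⟩
  · rw [hsrc]
    exact fun y hy => interior_subset hy.2.1
  · rw [hsrc]
    exact hf.mono fun y hy => interior_subset hy.2.1
  · intro z hz
    have hz' : (e₀.restr W).symm z ∈ e₀.source ∩ W := by
      rw [← hsrc]; exact (e₀.restr W).map_target hz
    obtain ⟨A', hA'⟩ := hz'.2.2
    have hd := ((hat _ hz'.2.1).differentiableAt (by simp)).hasFDerivAt
    rw [← hA'] at hd
    exact ((e₀.restr W).contDiffAt_symm hz hd (hat _ hz'.2.1)).contDiffWithinAt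

/-- The constant rank theorem: a smooth map of constant rank `r` has, locally, the same fibres as
the projection onto the first `r` coordinates of some coordinate system. -/
lemma exists_straightening_of_finrank_range_fderiv {E E' : Type*} [NormedAddCommGroup E]
    [NormedSpace ℝ E] [FiniteDimensional ℝ E] [NormedAddCommGroup E'] [NormedSpace ℝ E']
    [FiniteDimensional ℝ E'] {f : E → E'} {x : E} {U : Set E} (hU : U ∈ 𝓝 x)
    (hf : ContDiffOn ℝ ∞ f U) {r d : ℕ}
    (hr : ∀ y ∈ U, Module.finrank ℝ (fderiv ℝ f y).range = r)
    (hd : Module.finrank ℝ E = r + d) :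
    ∃ e : OpenPartialHomeomorph E (EuclideanSpace ℝ (Fin r) × EuclideanSpace ℝ (Fin d)),
      x ∈ e.source ∧ e.source ⊆ U ∧ ContDiffOn ℝ ∞ e e.source ∧ ContDiffOn ℝ ∞ e.symm e.target ∧
      ∀ a ∈ e.source, ∀ b ∈ e.source, (e a).1 = (e b).1 ↔ f a = f b := by
  have : CompleteSpace E := FiniteDimensional.complete ℝ E
  have hxU : x ∈ U := mem_of_mem_nhds hU
  set D := fderiv ℝ f x with hD
  obtain ⟨pr, hpr⟩ := D.range.subtype.exists_leftInverse_of_injective (by simp)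
  let ι : D.range ≃ₗ[ℝ] EuclideanSpace ℝ (Fin r) :=
    LinearEquiv.ofFinrankEq _ _ (by rw [finrank_euclideanSpace_fin]; exact hr x hxU)
  -- `Λ` is a linear coordinate on the range of the derivative at `x`; thus `Λ ∘ f` is a submersion
  -- at `x`, and `B` completes it to a local coordinate system.
  let Λ : E' →L[ℝ] EuclideanSpace ℝ (Fin r) :=
    LinearMap.toContinuousLinearMap (ι.toLinearMap ∘ₗ pr)
  have hΛ : Function.Surjective (Λ ∘L D) := by
    intro w
    obtain ⟨u, hu⟩ := (ι.symm w).2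
    refine ⟨u, ?_⟩
    have h1 : pr (D.range.subtype (ι.symm w)) = ι.symm w := LinearMap.congr_fun hpr _
    have h2 : D u = D.range.subtype (ι.symm w) := hu
    change ι (pr (D u)) = w
    rw [h2, h1, LinearEquiv.apply_symm_apply]
  obtain ⟨B, hB⟩ := exists_complement_of_surjective (Λ ∘L D) hΛ (d := d) (by simp [hd])
  let g : E → EuclideanSpace ℝ (Fin r) × EuclideanSpace ℝ (Fin d) := fun y => (Λ (f y), B y)
  have hg : ContDiffOn ℝ ∞ g U := (Λ.contDiff.comp_contDiffOn hf).prodMk B.contDiff.contDiffOn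
  have hgd : ∀ y, DifferentiableAt ℝ f y →
      HasFDerivAt g ((Λ ∘L fderiv ℝ f y).prod B) y := fun y hy =>
    (Λ.hasFDerivAt.comp y hy.hasFDerivAt).prodMk B.hasFDerivAt
  have hfx : DifferentiableAt ℝ f x := (hf.contDiffAt hU).differentiableAt (by simp)
  obtain ⟨e₀, hx₀, hsub, he₀, hs, ht⟩ := exists_openPartialHomeomorph_of_bijective_fderiv
    (f := g) (x := x) (U := interior U) (interior_mem_nhds.2 hU) (hg.mono interior_subset)
    (by rw [(hgd x hfx).fderiv]; exact hB)
  have hfd : ∀ y ∈ e₀.source, DifferentiableAt ℝ f y := fun y hy =>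
    (hf.contDiffAt (mem_interior_iff_mem_nhds.1 (hsub hy))).differentiableAt (by simp)
  obtain ⟨ε, hε, hball⟩ := Metric.isOpen_iff.1 e₀.open_target _ (e₀.map_source hx₀)
  -- In the sup norm a ball is a product of balls, so with this target the slices with fixed first
  -- coordinate are convex, and a zero derivative along them forces `f` to be constant there.
  let e := (e₀.symm.restr (Metric.ball (e₀ x) ε)).symm
  have htgt : e.target = Metric.ball (e₀ x) ε := by
    change (e₀.symm.restr (Metric.ball (e₀ x) ε)).source = _
    rw [OpenPartialHomeomorph.restr_source, Metric.isOpen_ball.interior_eq]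
    exact inter_eq_right.2 hball
  have hesrc : e.source ⊆ e₀.source := by
    intro y hy
    have h1 : e y ∈ e.target := e.map_source hy
    rw [htgt] at h1
    have := e₀.symm.map_source (hball h1)
    have h2 : e₀.symm (e y) = y := e.left_inv hy
    rwa [h2] at this
  have hcoe : ∀ y, e y = g y := he₀
  refine ⟨e, ?_, fun y hy => interior_subset (hsub (hesrc hy)), hs.mono hesrc,
    ht.mono (htgt ▸ hball), ?_⟩
  · have h1 : e₀ x ∈ e.target := htgt ▸ Metric.mem_ball_self hε
    have := e.map_target h1
    have h2 : e.symm (e₀ x) = x := e₀.left_inv hx₀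
    rwa [h2] at this
  intro a ha b hb
  refine ⟨fun hab => ?_, fun hab => by rw [hcoe, hcoe]; simp [g, hab]⟩
  set c := (e a).1 with hc
  have hmem : ∀ w ∈ Metric.ball (e₀ x).2 ε, (c, w) ∈ e.target := by
    intro w hw
    have h1 := e.map_source ha
    rw [htgt, ← ball_prod_same] at h1
    rw [htgt, ← ball_prod_same]
    exact ⟨h1.1, hw⟩
  have hderiv : ∀ w ∈ Metric.ball (e₀ x).2 ε,
      HasFDerivAt (fun w => f (e.symm (c, w))) (0 : EuclideanSpace ℝ (Fin d) →L[ℝ] E') w := by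
    intro w hw
    have hz := hmem w hw
    set y := e.symm (c, w) with hy
    have hys : y ∈ e₀.source := hesrc (e.map_target hz)
    have hT : HasFDerivAt e.symm (fderiv ℝ e.symm (c, w)) (c, w) :=
      ((ht.mono (htgt ▸ hball)).contDiffAt (e.open_target.mem_nhds hz)).differentiableAt
        (by simp) |>.hasFDerivAt
    set T := fderiv ℝ e.symm (c, w)
    have hcomp : ((Λ ∘L fderiv ℝ f y).prod B) ∘L T = ContinuousLinearMap.id ℝ _ := by
      have h1 : HasFDerivAt (fun z => g (e.symm z)) (((Λ ∘L fderiv ℝ f y).prod B) ∘L T) (c, w) :=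
        (hgd y (hfd y hys)).comp (c, w) hT
      have h2 : (fun z => g (e.symm z)) =ᶠ[𝓝 (c, w)] id := by
        filter_upwards [e.open_target.mem_nhds hz] with z hz'
        rw [← hcoe, e.right_inv hz', id]
      exact h1.unique ((hasFDerivAt_id _).congr_of_eventuallyEq h2)
    -- This is where constant rank enters: `Λ` maps the `r`-dimensional range at `y` onto an
    -- `r`-dimensional space, hence injectively. A tangent vector of the slice has zero
    -- `Λ`-component, so `f` has zero derivative in its direction.
    have hsurj : Function.Surjective
        ((Λ : E' →ₗ[ℝ] EuclideanSpace ℝ (Fin r)).domRestrict (fderiv ℝ f y).range) := by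
      intro v
      refine ⟨⟨fderiv ℝ f y (T (v, 0)), ⟨_, rfl⟩⟩, ?_⟩
      exact congrArg Prod.fst (DFunLike.congr_fun hcomp (v, 0))
    have hinj := (LinearMap.injective_iff_surjective_of_finrank_eq_finrank
      (by simp [hr y (interior_subset (hsub hys))])).2 hsurj
    have hcomp2 : HasFDerivAt (fun w => f (e.symm (c, w)))
        (fderiv ℝ f y ∘L T ∘L ContinuousLinearMap.inr ℝ _ _) w :=
      (hfd y hys).hasFDerivAt.comp w (hT.comp w (hasFDerivAt_prodMk_right c w))
    convert hcomp2 using 1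
    ext1 v
    have h3 : Λ (fderiv ℝ f y (T (0, v))) = 0 :=
      congrArg Prod.fst (DFunLike.congr_fun hcomp (0, v))
    have h4 : (⟨fderiv ℝ f y (T (0, v)), ⟨_, rfl⟩⟩ : (fderiv ℝ f y).range) = 0 :=
      hinj (by rw [map_zero]; exact h3)
    exact (congrArg Subtype.val h4).symm
  have hmem2 : ∀ y ∈ e.source, (e y).2 ∈ Metric.ball (e₀ x).2 ε := by
    intro y hy
    have h1 := e.map_source hy
    rw [htgt, ← ball_prod_same] at h1
    exact h1.2
  have this := Metric.isOpen_ball.is_const_of_fderiv_eq_zero (𝕜 := ℝ)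
    (s := Metric.ball (e₀ x).2 ε) (f := fun w => f (e.symm (c, w)))
    (convex_ball _ _).isPreconnected
    (fun w hw => (hderiv w hw).differentiableAt.differentiableWithinAt)
    (fun w hw => (hderiv w hw).fderiv) (hmem2 a ha) (hmem2 b hb)
  have ha' : (c, (e a).2) = e a := rfl
  have hb' : (c, (e b).2) = e b := by rw [hab]
  simpa only [ha', hb', e.left_inv ha, e.left_inv hb] using this

/-! ### Partial diffeomorphisms; inverse function and constant rank theorems on manifolds. -/

section LocalDiffeo

variable {E H M E' H' N E'' H'' Q : Type*} [NormedAddCommGroup E] [NormedSpace ℝ E]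
  [TopologicalSpace H] [TopologicalSpace M] [ChartedSpace H M] {I : ModelWithCorners ℝ E H}
  [NormedAddCommGroup E'] [NormedSpace ℝ E']
  [TopologicalSpace H'] [TopologicalSpace N] [ChartedSpace H' N] {J : ModelWithCorners ℝ E' H'}
  [NormedAddCommGroup E''] [NormedSpace ℝ E'']
  [TopologicalSpace H''] {K : ModelWithCorners ℝ E'' H''}
  [TopologicalSpace Q] [ChartedSpace H'' Q]

/-- An open partial homeomorphism which is smooth in both directions. -/
structure IsPartialDiffeo (I : ModelWithCorners ℝ E H) (J : ModelWithCorners ℝ E' H')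
    (e : OpenPartialHomeomorph M N) : Prop where
  smooth : ContMDiffOn I J ∞ e e.source
  smooth_symm : ContMDiffOn J I ∞ e.symm e.target

lemma IsPartialDiffeo.contMDiffAt {e : OpenPartialHomeomorph M N} (he : IsPartialDiffeo I J e)
    {x : M} (hx : x ∈ e.source) : ContMDiffAt I J ∞ e x :=
  he.smooth.contMDiffAt (e.open_source.mem_nhds hx)

lemma IsPartialDiffeo.contMDiffAt_symm {e : OpenPartialHomeomorph M N}
    (he : IsPartialDiffeo I J e) {y : N} (hy : y ∈ e.target) : ContMDiffAt J I ∞ e.symm y :=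
  he.smooth_symm.contMDiffAt (e.open_target.mem_nhds hy)

lemma IsPartialDiffeo.symm {e : OpenPartialHomeomorph M N} (he : IsPartialDiffeo I J e) :
    IsPartialDiffeo J I e.symm :=
  ⟨he.smooth_symm, by simpa using he.smooth⟩

lemma IsPartialDiffeo.trans {e : OpenPartialHomeomorph M N} {e' : OpenPartialHomeomorph N Q}
    (he : IsPartialDiffeo I J e) (he' : IsPartialDiffeo J K e') :
    IsPartialDiffeo I K (e.trans e') := by
  refine ⟨fun y hy => ?_, fun y hy => ?_⟩
  · rw [OpenPartialHomeomorph.trans_source] at hy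
    exact ((he'.contMDiffAt hy.2).comp y (he.contMDiffAt hy.1)).contMDiffWithinAt
  · rw [OpenPartialHomeomorph.trans_target] at hy
    exact ((he.contMDiffAt_symm hy.2).comp y (he'.contMDiffAt_symm hy.1)).contMDiffWithinAt

lemma isPartialDiffeo_of_contDiffOn {e : OpenPartialHomeomorph E E'}
    (h : ContDiffOn ℝ ∞ e e.source) (h' : ContDiffOn ℝ ∞ e.symm e.target) :
    IsPartialDiffeo 𝓘(ℝ, E) 𝓘(ℝ, E') e :=
  ⟨h.contMDiffOn, h'.contMDiffOn⟩

lemma ContinuousLinearEquiv.isPartialDiffeo (A : E ≃L[ℝ] E') :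
    IsPartialDiffeo 𝓘(ℝ, E) 𝓘(ℝ, E') A.toHomeomorph.toOpenPartialHomeomorph :=
  isPartialDiffeo_of_contDiffOn A.contDiff.contDiffOn A.symm.contDiff.contDiffOn

lemma ModelWithCorners.isPartialDiffeo (I : ModelWithCorners ℝ E H) [I.Boundaryless] :
    IsPartialDiffeo I 𝓘(ℝ, E) I.toHomeomorph.toOpenPartialHomeomorph :=
  ⟨I.contMDiff.contMDiffOn, I.contMDiffOn_symm.mono (by simp [I.range_eq_univ])⟩

variable (I) in
/-- The preferred chart at `x`, as an open partial homeomorphism with values in the model vector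
space. -/
noncomputable def modelChart [I.Boundaryless] (x : M) : OpenPartialHomeomorph M E :=
  (chartAt H x).trans I.toHomeomorph.toOpenPartialHomeomorph

lemma mem_modelChart_source [I.Boundaryless] (x : M) : x ∈ (modelChart I x).source := by
  simp [modelChart]

lemma modelChart_source [I.Boundaryless] (x : M) :
    (modelChart I x).source = (chartAt H x).source := by
  simp [modelChart]

lemma IsPartialDiffeo.of_mem_maximalAtlas {e : OpenPartialHomeomorph M H}
    (he : e ∈ IsManifold.maximalAtlas I ∞ M) : IsPartialDiffeo I I e :=
  ⟨contMDiffOn_of_mem_maximalAtlas he, contMDiffOn_symm_of_mem_maximalAtlas he⟩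

lemma isPartialDiffeo_modelChart [I.Boundaryless] [IsManifold I ∞ M] (x : M) :
    IsPartialDiffeo I 𝓘(ℝ, E) (modelChart I x) :=
  (IsPartialDiffeo.of_mem_maximalAtlas (IsManifold.chart_mem_maximalAtlas x)).trans
    I.isPartialDiffeo

variable (I J) in
/-- The derivative of `f` at `x`, as a linear map between the model vector spaces. -/
noncomputable def mderiv (f : M → N) (x : M) : E →L[ℝ] E' := mfderiv I J f x

lemma mderiv_comp {g : N → Q} {f : M → N} {x : M} (hg : MDifferentiableAt J K g (f x))
    (hf : MDifferentiableAt I J f x) :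
    mderiv I K (fun y => g (f y)) x = mderiv J K g (f x) ∘L mderiv I J f x :=
  mfderiv_comp x hg hf

lemma mderiv_congr {f g : M → N} {x : M} (h : f =ᶠ[𝓝 x] g) : mderiv I J f x = mderiv I J g x :=
  h.mfderiv_eq

lemma mderiv_id' (x : M) : mderiv I I (fun y : M => y) x = ContinuousLinearMap.id ℝ E :=
  mfderiv_id

lemma mderiv_eq_fderiv (f : E → E') (x : E) : mderiv 𝓘(ℝ, E) 𝓘(ℝ, E') f x = fderiv ℝ f x :=
  mfderiv_eq_fderiv

/-- If `g` is a local left inverse of `f`, its derivative is a left inverse of that of `f`. -/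
lemma mderiv_comp_eq_id {f : M → N} {g : N → M} {x : M} (hg : MDifferentiableAt J I g (f x))
    (hf : MDifferentiableAt I J f x) (h : ∀ᶠ y in 𝓝 x, g (f y) = y) (v : E) :
    mderiv J I g (f x) (mderiv I J f x v) = v := by
  have h1 := mderiv_comp hg hf
  rw [mderiv_congr (g := fun y => y) h, mderiv_id'] at h1
  exact (DFunLike.congr_fun h1 v).symm

lemma IsPartialDiffeo.bijective_mderiv {e : OpenPartialHomeomorph M N}
    (he : IsPartialDiffeo I J e) {x : M} (hx : x ∈ e.source) :
    Function.Bijective (mderiv I J e x) := by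
  have hy := e.map_source hx
  have h1 : MDifferentiableAt I J e x := (he.contMDiffAt hx).mdifferentiableAt (by simp)
  have h2 : MDifferentiableAt J I e.symm (e x) :=
    (he.contMDiffAt_symm hy).mdifferentiableAt (by simp)
  have h1' : MDifferentiableAt I J e (e.symm (e x)) := by rwa [e.left_inv hx]
  refine ⟨Function.LeftInverse.injective (g := mderiv J I e.symm (e x))
    (mderiv_comp_eq_id h2 h1 (e.eventually_left_inverse hx)),
    Function.RightInverse.surjective (g := mderiv J I e.symm (e x)) ?_⟩
  have := mderiv_comp_eq_id h1' h2 (e.eventually_right_inverse hy)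
  rwa [e.left_inv hx] at this

variable [I.Boundaryless] [J.Boundaryless]

variable (I J) in
/-- The map `f` read in the preferred charts at `x` and `f x`. -/
noncomputable def inCharts (f : M → N) (x : M) : E → E' :=
  modelChart J (f x) ∘ f ∘ (modelChart I x).symm

variable (I J) in
/-- The set on which `inCharts I J f x` represents `f`. -/
noncomputable def inChartsDomain (f : M → N) (x : M) (U : Set M) : Set E :=
  (modelChart I x).target ∩
    (modelChart I x).symm ⁻¹' (U ∩ f ⁻¹' (modelChart J (f x)).source)

lemma inChartsDomain_mem_nhds {f : M → N} {x : M} {U : Set M} (hU : IsOpen U) (hxU : x ∈ U)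
    (hf : ContMDiffOn I J ∞ f U) : inChartsDomain I J f x U ∈ 𝓝 (modelChart I x x) := by
  have hx := mem_modelChart_source (I := I) x
  have ht := (modelChart I x).map_source hx
  refine Filter.inter_mem ((modelChart I x).open_target.mem_nhds ht) ?_
  refine ((modelChart I x).continuousAt_symm ht).preimage_mem_nhds ?_
  rw [(modelChart I x).left_inv hx]
  refine Filter.inter_mem (hU.mem_nhds hxU) ?_
  exact (hf.continuousOn.continuousAt (hU.mem_nhds hxU)).preimage_mem_nhds
    ((modelChart J (f x)).open_source.mem_nhds (mem_modelChart_source _))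

lemma mem_inChartsDomain_self {f : M → N} {x : M} {U : Set M} (hU : IsOpen U) (hxU : x ∈ U)
    (hf : ContMDiffOn I J ∞ f U) : modelChart I x x ∈ inChartsDomain I J f x U :=
  mem_of_mem_nhds (inChartsDomain_mem_nhds hU hxU hf)

variable [IsManifold I ∞ M] [IsManifold J ∞ N]

lemma contDiffOn_inCharts {f : M → N} {x : M} {U : Set M} (hU : IsOpen U)
    (hf : ContMDiffOn I J ∞ f U) :
    ContDiffOn ℝ ∞ (inCharts I J f x) (inChartsDomain I J f x U) := by
  intro z hz
  rw [← contMDiffWithinAt_iff_contDiffWithinAt]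
  refine ContMDiffAt.contMDiffWithinAt ?_
  exact ((isPartialDiffeo_modelChart (f x)).contMDiffAt hz.2.2).comp z
    ((hf.contMDiffAt (hU.mem_nhds hz.2.1)).comp z
      ((isPartialDiffeo_modelChart x).contMDiffAt_symm hz.1))

/-- The factors `A` and `B` are the derivatives of the charts. Their bijectivity is all that is
needed to transfer rank and invertibility between `f` and its local expression. -/
lemma fderiv_inCharts {f : M → N} {x : M} {U : Set M} (hU : IsOpen U)
    (hf : ContMDiffOn I J ∞ f U) {z : E} (hz : z ∈ inChartsDomain I J f x U) :
    ∃ (A : E →L[ℝ] E) (B : E' →L[ℝ] E'), Function.Bijective A ∧ Function.Bijective B ∧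
      fderiv ℝ (inCharts I J f x) z = B ∘L mderiv I J f ((modelChart I x).symm z) ∘L A := by
  refine ⟨_, _, (isPartialDiffeo_modelChart x).symm.bijective_mderiv hz.1,
    (isPartialDiffeo_modelChart (f x)).bijective_mderiv hz.2.2, ?_⟩
  have h1 : MDifferentiableAt 𝓘(ℝ, E) I (modelChart I x).symm z :=
    ((isPartialDiffeo_modelChart x).contMDiffAt_symm hz.1).mdifferentiableAt (by simp)
  have h2 : MDifferentiableAt I J f ((modelChart I x).symm z) :=
    (hf.contMDiffAt (hU.mem_nhds hz.2.1)).mdifferentiableAt (by simp)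
  have h3 : MDifferentiableAt J 𝓘(ℝ, E') (modelChart J (f x)) (f ((modelChart I x).symm z)) :=
    ((isPartialDiffeo_modelChart (f x)).contMDiffAt hz.2.2).mdifferentiableAt (by simp)
  rw [← mderiv_comp h2 h1, ← mderiv_comp (f := fun z => f ((modelChart I x).symm z)) h3
    (h2.comp z h1), mderiv_eq_fderiv]
  rfl

lemma finrank_range_comp_comp (A : E →L[ℝ] E) (B : E' →L[ℝ] E') (D : E →L[ℝ] E')
    (hA : Function.Surjective A) (hB : Function.Injective B) :
    Module.finrank ℝ (B ∘L D ∘L A).range = Module.finrank ℝ D.range := by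
  have h1 : (B ∘L D ∘L A).range = D.range.map (B : E' →ₗ[ℝ] E') := by
    ext v
    constructor
    · rintro ⟨u, rfl⟩
      exact ⟨_, ⟨A u, rfl⟩, rfl⟩
    · rintro ⟨_, ⟨u, rfl⟩, rfl⟩
      obtain ⟨u, rfl⟩ := hA u
      exact ⟨u, rfl⟩
  rw [h1]
  exact (Submodule.equivMapOfInjective (B : E' →ₗ[ℝ] E') hB D.range).finrank_eq.symm

lemma bijective_comp_comp {A : E →L[ℝ] E} {B : E' →L[ℝ] E'} {D : E →L[ℝ] E'}
    (hA : Function.Bijective A) (hB : Function.Bijective B) (hD : Function.Bijective D) :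
    Function.Bijective (B ∘L D ∘L A) :=
  hB.comp (hD.comp hA)

/-- The inverse function theorem for manifolds. -/
lemma exists_isPartialDiffeo_of_bijective_mderiv [CompleteSpace E] [CompleteSpace E']
    {f : M → N} {x : M} {U : Set M} (hU : IsOpen U) (hxU : x ∈ U)
    (hf : ContMDiffOn I J ∞ f U) (hb : Function.Bijective (mderiv I J f x)) :
    ∃ e : OpenPartialHomeomorph M N, x ∈ e.source ∧ e.source ⊆ U ∧ EqOn e f e.source ∧
      IsPartialDiffeo I J e := by
  have hx := mem_modelChart_source (I := I) x
  obtain ⟨A, B, hA, hB, hAB⟩ := fderiv_inCharts hU hf (mem_inChartsDomain_self hU hxU hf)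
  rw [(modelChart I x).left_inv hx] at hAB
  obtain ⟨e₀, hx₀, hsub, he₀, hs, ht⟩ := exists_openPartialHomeomorph_of_bijective_fderiv
    (inChartsDomain_mem_nhds hU hxU hf) (contDiffOn_inCharts hU hf)
    (by rw [hAB]; exact bijective_comp_comp hA hB hb)
  have hval : ∀ y ∈ (modelChart I x).source, e₀ (modelChart I x y) = modelChart J (f x) (f y) := by
    intro y hy
    rw [he₀]
    simp only [inCharts, Function.comp_apply, (modelChart I x).left_inv hy]
  refine ⟨((modelChart I x).trans e₀).trans (modelChart J (f x)).symm, ?_, ?_, ?_,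
    ((isPartialDiffeo_modelChart x).trans (isPartialDiffeo_of_contDiffOn hs ht)).trans
      (isPartialDiffeo_modelChart (f x)).symm⟩
  · simp only [OpenPartialHomeomorph.trans_source, OpenPartialHomeomorph.coe_trans, mem_inter_iff,
      mem_preimage, Function.comp_apply, OpenPartialHomeomorph.symm_source]
    refine ⟨⟨hx, hx₀⟩, ?_⟩
    rw [hval x hx]
    exact (modelChart J (f x)).map_source (mem_modelChart_source _)
  · intro y hy
    simp only [OpenPartialHomeomorph.trans_source, mem_inter_iff, mem_preimage] at hy
    have := (hsub hy.1.2).2.1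
    rwa [(modelChart I x).left_inv hy.1.1] at this
  · intro y hy
    simp only [OpenPartialHomeomorph.trans_source, mem_inter_iff, mem_preimage] at hy
    have := (hsub hy.1.2).2.2
    rw [mem_preimage, (modelChart I x).left_inv hy.1.1] at this
    simp only [OpenPartialHomeomorph.coe_trans, Function.comp_apply]
    rw [hval y hy.1.1, (modelChart J (f x)).left_inv this]

/-- The constant rank theorem for manifolds: a map of constant rank has, locally, the same fibres
as a projection in suitable coordinates. -/
lemma exists_straightening_of_finrank_range_mderiv [FiniteDimensional ℝ E] [FiniteDimensional ℝ E']
    {f : M → N} (hf : ContMDiff I J ∞ f) {r d : ℕ}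
    (hr : ∀ y, Module.finrank ℝ (mderiv I J f y).range = r) (hd : Module.finrank ℝ E = r + d)
    (x : M) :
    ∃ e : OpenPartialHomeomorph M (EuclideanSpace ℝ (Fin r) × EuclideanSpace ℝ (Fin d)),
      x ∈ e.source ∧
      IsPartialDiffeo I 𝓘(ℝ, EuclideanSpace ℝ (Fin r) × EuclideanSpace ℝ (Fin d)) e ∧
      ∀ a ∈ e.source, ∀ b ∈ e.source, (e a).1 = (e b).1 ↔ f a = f b := by
  have hx := mem_modelChart_source (I := I) x
  obtain ⟨e₀, hx₀, hsub, hs, ht, hfib⟩ := exists_straightening_of_finrank_range_fderiv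
    (inChartsDomain_mem_nhds isOpen_univ (mem_univ x) hf.contMDiffOn)
    (contDiffOn_inCharts isOpen_univ hf.contMDiffOn) (r := r) (d := d)
    (fun z hz => by
      obtain ⟨A, B, hA, hB, hAB⟩ := fderiv_inCharts isOpen_univ hf.contMDiffOn hz
      rw [hAB, finrank_range_comp_comp A B _ hA.2 hB.1, hr]) hd
  refine ⟨(modelChart I x).trans e₀, ⟨hx, hx₀⟩,
    (isPartialDiffeo_modelChart x).trans (isPartialDiffeo_of_contDiffOn hs ht), ?_⟩
  intro a ha b hb
  rw [OpenPartialHomeomorph.trans_source] at ha hb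
  have ha2 := (hsub ha.2).2.2
  have hb2 := (hsub hb.2).2.2
  rw [mem_preimage, (modelChart I x).left_inv ha.1] at ha2
  rw [mem_preimage, (modelChart I x).left_inv hb.1] at hb2
  refine (hfib _ ha.2 _ hb.2).trans ?_
  simp only [inCharts, Function.comp_apply, (modelChart I x).left_inv ha.1,
    (modelChart I x).left_inv hb.1]
  exact (modelChart J (f x)).injOn.eq_iff ha2 hb2

end LocalDiffeo

/-! ### Normal forms of submersions and immersions. -/

section NormalForms

variable {E H M E' H' N E'' H'' Q : Type*} [NormedAddCommGroup E] [NormedSpace ℝ E]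
  [TopologicalSpace H] [TopologicalSpace M] [ChartedSpace H M] {I : ModelWithCorners ℝ E H}
  [NormedAddCommGroup E'] [NormedSpace ℝ E']
  [TopologicalSpace H'] [TopologicalSpace N] [ChartedSpace H' N] {J : ModelWithCorners ℝ E' H'}
  [NormedAddCommGroup E''] [NormedSpace ℝ E'']
  [TopologicalSpace H''] [TopologicalSpace Q] [ChartedSpace H'' Q]
  {K : ModelWithCorners ℝ E'' H''}

lemma IsPartialDiffeo.mem_maximalAtlas [IsManifold I ∞ M] {e : OpenPartialHomeomorph M H}
    (he : IsPartialDiffeo I I e) : e ∈ IsManifold.maximalAtlas I ∞ M :=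
  e.mem_maximalAtlas_of_contMDiffOn he.smooth he.smooth_symm

variable [FiniteDimensional ℝ E] [FiniteDimensional ℝ E'] [I.Boundaryless] [J.Boundaryless]
  [IsManifold I ∞ M] [IsManifold J ∞ N]

/-- A smooth map with surjective derivative is a submersion. -/
lemma isSubmersionAtOfComplement_of_surjective_mderiv {f : M → N} (hf : ContMDiff I J ∞ f) {d : ℕ}
    (hd : Module.finrank ℝ E = Module.finrank ℝ E' + d) {x : M}
    (hx : Function.Surjective (mderiv I J f x)) :
    Manifold.IsSubmersionAtOfComplement (EuclideanSpace ℝ (Fin d)) I J ∞ f x := by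
  have : CompleteSpace E := FiniteDimensional.complete ℝ E
  have : CompleteSpace E' := FiniteDimensional.complete ℝ E'
  have hxs := mem_modelChart_source (I := I) x
  have hnhds := inChartsDomain_mem_nhds isOpen_univ (mem_univ x) hf.contMDiffOn
  obtain ⟨A, B, hA, hB, hAB⟩ := fderiv_inCharts isOpen_univ hf.contMDiffOn (mem_of_mem_nhds hnhds)
  rw [(modelChart I x).left_inv hxs] at hAB
  obtain ⟨C, hC⟩ := exists_complement_of_surjective (fderiv ℝ (inCharts I J f x) (modelChart I x x))
    (by rw [hAB]; exact hB.2.comp (hx.comp hA.2)) hd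
  have hsm := contDiffOn_inCharts (x := x) isOpen_univ hf.contMDiffOn
  have hdiff : DifferentiableAt ℝ (inCharts I J f x) (modelChart I x x) :=
    (hsm.contDiffAt hnhds).differentiableAt (by simp)
  obtain ⟨e₀, hx₀, hsub, he₀, hs, ht⟩ := exists_openPartialHomeomorph_of_bijective_fderiv
    (f := fun z => (inCharts I J f x z, C z)) hnhds (hsm.prodMk C.contDiff.contDiffOn)
    (by rw [(hdiff.hasFDerivAt.prodMk C.hasFDerivAt).fderiv]; exact hC)
  let Θ : E ≃L[ℝ] E' × EuclideanSpace ℝ (Fin d) :=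
    ContinuousLinearEquiv.ofFinrankEq (by simp [hd])
  let e : OpenPartialHomeomorph M H := (((modelChart I x).trans e₀).trans
    Θ.symm.toHomeomorph.toOpenPartialHomeomorph).trans
      I.toHomeomorph.toOpenPartialHomeomorph.symm
  have he : IsPartialDiffeo I I e := (((isPartialDiffeo_modelChart x).trans
    (isPartialDiffeo_of_contDiffOn hs ht)).trans Θ.symm.isPartialDiffeo).trans
      I.isPartialDiffeo.symm
  have hsrc : e.source = (modelChart I x).source ∩ (modelChart I x) ⁻¹' e₀.source := by
    simp [e]
  refine Manifold.IsSubmersionAtOfComplement.mk_of_charts Θ e (chartAt H' (f x)) ?_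
    (mem_chart_source _ _) he.mem_maximalAtlas (IsManifold.chart_mem_maximalAtlas _) ?_ ?_
  · rw [hsrc]; exact ⟨hxs, hx₀⟩
  · intro y hy
    rw [hsrc] at hy
    have := (hsub hy.2).2.2
    rwa [mem_preimage, (modelChart I x).left_inv hy.1, modelChart_source] at this
  · intro z hz
    obtain ⟨y, hy, rfl⟩ : ∃ y ∈ e.source, I (e y) = z := by
      have h1 := (e.extend I).map_target hz
      rw [OpenPartialHomeomorph.extend_source] at h1
      exact ⟨_, h1, (e.extend I).right_inv hz⟩
    have h2 : (e.extend I).symm (I (e y)) = y := by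
      have := (e.extend I).left_inv (x := y) (by rwa [OpenPartialHomeomorph.extend_source])
      simpa using this
    rw [hsrc] at hy
    have h3 : I (e y) = Θ.symm (e₀ (modelChart I x y)) := I.toHomeomorph.apply_symm_apply _
    simp only [Function.comp_apply]
    rw [h2, h3, Θ.apply_symm_apply, he₀]
    simp only [inCharts, Function.comp_apply, (modelChart I x).left_inv hy.1]
    rfl

/-- A smooth map with injective derivative is an immersion. -/
lemma isImmersionAtOfComplement_of_injective_mderiv {f : M → N} (hf : ContMDiff I J ∞ f) {d : ℕ}
    (hd : Module.finrank ℝ E' = Module.finrank ℝ E + d) {x : M}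
    (hx : Function.Injective (mderiv I J f x)) :
    Manifold.IsImmersionAtOfComplement (EuclideanSpace ℝ (Fin d)) I J ∞ f x := by
  have : CompleteSpace E := FiniteDimensional.complete ℝ E
  have : CompleteSpace E' := FiniteDimensional.complete ℝ E'
  have hxs := mem_modelChart_source (I := I) x
  have hnhds := inChartsDomain_mem_nhds isOpen_univ (mem_univ x) hf.contMDiffOn
  obtain ⟨A, B, hA, hB, hAB⟩ := fderiv_inCharts isOpen_univ hf.contMDiffOn (mem_of_mem_nhds hnhds)
  rw [(modelChart I x).left_inv hxs] at hAB
  obtain ⟨C, hC⟩ := exists_complement_of_injective (fderiv ℝ (inCharts I J f x) (modelChart I x x))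
    (by rw [hAB]; exact hB.1.comp (hx.comp hA.1)) hd
  have hsm := contDiffOn_inCharts (x := x) isOpen_univ hf.contMDiffOn
  have hdiff : DifferentiableAt ℝ (inCharts I J f x) (modelChart I x x) :=
    (hsm.contDiffAt hnhds).differentiableAt (by simp)
  -- Adding a complement `C` of the tangent image thickens the immersion to a map `(z, w) ↦ f z + C
  -- w` with invertible derivative; its inverse straightens the image of `f` to `w = 0`.
  have hfd : HasFDerivAt (fun z : E × EuclideanSpace ℝ (Fin d) => inCharts I J f x z.1 + C z.2)
      ((fderiv ℝ (inCharts I J f x) (modelChart I x x)).coprod C) (modelChart I x x, 0) := by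
    have h1 := (hdiff.hasFDerivAt.comp (modelChart I x x, (0 : EuclideanSpace ℝ (Fin d)))
      (hasFDerivAt_fst (𝕜 := ℝ))).add (C.hasFDerivAt.comp (modelChart I x x, 0) hasFDerivAt_snd)
    refine h1.congr_fderiv ?_
    ext v <;> simp
  obtain ⟨e₀, hx₀, hsub, he₀, hs, ht⟩ := exists_openPartialHomeomorph_of_bijective_fderiv
    (f := fun z : E × EuclideanSpace ℝ (Fin d) => inCharts I J f x z.1 + C z.2)
    (x := (modelChart I x x, 0)) (U := Prod.fst ⁻¹' inChartsDomain I J f x univ)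
    (continuousAt_fst.preimage_mem_nhds hnhds)
    ((hsm.comp contDiff_fst.contDiffOn (fun z hz => hz)).add
      (C.contDiff.comp contDiff_snd).contDiffOn)
    (by rw [hfd.fderiv]; exact hC)
  let Θ : (E × EuclideanSpace ℝ (Fin d)) ≃L[ℝ] E' :=
    ContinuousLinearEquiv.ofFinrankEq (by simp [hd])
  let e' : OpenPartialHomeomorph N H' := (((modelChart J (f x)).trans e₀.symm).trans
    Θ.toHomeomorph.toOpenPartialHomeomorph).trans J.toHomeomorph.toOpenPartialHomeomorph.symm
  have he' : IsPartialDiffeo J J e' := (((isPartialDiffeo_modelChart (f x)).trans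
    (isPartialDiffeo_of_contDiffOn hs ht).symm).trans Θ.isPartialDiffeo).trans
      J.isPartialDiffeo.symm
  have hsrc' : e'.source = (modelChart J (f x)).source ∩ modelChart J (f x) ⁻¹' e₀.target := by
    simp [e']
  let W : Set M := (modelChart I x).source ∩
    modelChart I x ⁻¹' ((fun a => (a, (0 : EuclideanSpace ℝ (Fin d)))) ⁻¹' e₀.source)
  have hW : IsOpen W := (modelChart I x).continuousOn.isOpen_inter_preimage
    (modelChart I x).open_source (e₀.open_source.preimage (by fun_prop))
  have hWf : ∀ y ∈ W, f y ∈ (modelChart J (f x)).source ∧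
      e₀ (modelChart I x y, 0) = modelChart J (f x) (f y) := by
    intro y hy
    have h1 := (hsub hy.2).2.2
    rw [mem_preimage, (modelChart I x).left_inv hy.1] at h1
    refine ⟨h1, ?_⟩
    rw [he₀]
    simp [inCharts, (modelChart I x).left_inv hy.1]
  have hWe : ∀ y ∈ W, f y ∈ e'.source ∧ J (e' (f y)) = Θ (modelChart I x y, 0) := by
    intro y hy
    obtain ⟨h1, h2⟩ := hWf y hy
    refine ⟨?_, ?_⟩
    · rw [hsrc']
      refine ⟨h1, ?_⟩
      rw [mem_preimage, ← h2]
      exact e₀.map_source hy.2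
    · have h3 : J (e' (f y)) = Θ (e₀.symm (modelChart J (f x) (f y))) :=
        J.toHomeomorph.apply_symm_apply _
      rw [h3, ← h2, e₀.left_inv hy.2]
  let e := (chartAt H x).restr W
  have hesrc : e.source = W := by
    change ((chartAt H x).restr W).source = W
    rw [OpenPartialHomeomorph.restr_source, hW.interior_eq]
    refine inter_eq_right.2 fun y hy => ?_
    rw [← modelChart_source (I := I)]
    exact hy.1
  refine Manifold.IsImmersionAtOfComplement.mk_of_continuousAt hf.continuous.continuousAt Θ e e' ?_
    (hWe x ⟨hxs, hx₀⟩).1 ?_ he'.mem_maximalAtlas ?_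
  · rw [hesrc]; exact ⟨hxs, hx₀⟩
  · exact restr_mem_maximalAtlas _ (IsManifold.chart_mem_maximalAtlas x) hW
  · intro z hz
    obtain ⟨y, hy, rfl⟩ : ∃ y ∈ e.source, I (e y) = z := by
      have h1 := (e.extend I).map_target hz
      rw [OpenPartialHomeomorph.extend_source] at h1
      exact ⟨_, h1, (e.extend I).right_inv hz⟩
    have h2 : (e.extend I).symm (I (e y)) = y := by
      have := (e.extend I).left_inv (x := y) (by rwa [OpenPartialHomeomorph.extend_source])
      simpa using this
    rw [hesrc] at hy
    simp only [Function.comp_apply]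
    rw [h2]
    exact (hWe y hy).2

/-- A smooth map whose derivatives are injective is an immersion. -/
lemma isImmersion_of_injective_mderiv {f : M → N} (hf : ContMDiff I J ∞ f)
    (h : ∀ x, Function.Injective (mderiv I J f x)) : Manifold.IsImmersion I J ∞ f := by
  -- If `M` is empty, no derivative compares the dimensions, and an arbitrary complement serves.
  rcases isEmpty_or_nonempty M with hM | ⟨⟨x⟩⟩
  · exact Manifold.IsImmersionOfComplement.isImmersion (F := PUnit.{1}) fun x => hM.elim x
  have := LinearMap.finrank_le_finrank_of_injective (f := (mderiv I J f x : E →ₗ[ℝ] E')) (h x)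
  exact Manifold.IsImmersionOfComplement.isImmersion fun x =>
    isImmersionAtOfComplement_of_injective_mderiv hf (Nat.add_sub_of_le this).symm (h x)

/-- A smooth map with smooth local sections through all points. -/
structure HasLocalSections (I : ModelWithCorners ℝ E H) (J : ModelWithCorners ℝ E' H')
    (f : M → N) : Prop where
  smooth : ContMDiff I J ∞ f
  exists_section : ∀ x, ∃ σ : N → M, ContMDiffAt J I ∞ σ (f x) ∧ σ (f x) = x ∧
    ∀ᶠ y in 𝓝 (f x), f (σ y) = y

/-- Differentiating `f ∘ σ = id` gives a right inverse of the derivative at each point. -/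
lemma HasLocalSections.isSubmersion {f : M → N} (hf : HasLocalSections I J f) :
    Manifold.IsSubmersion I J ∞ f := by
  have h : ∀ x, Function.Surjective (mderiv I J f x) := by
    intro x
    obtain ⟨σ, hσ, hx, hs⟩ := hf.exists_section x
    have := mderiv_comp_eq_id (f := σ) (g := f) (x := f x)
      ((hf.smooth.contMDiffAt).mdifferentiableAt (by simp)) (hσ.mdifferentiableAt (by simp)) hs
    rw [hx] at this
    exact Function.RightInverse.surjective this
  rcases isEmpty_or_nonempty M with hM | ⟨⟨x⟩⟩
  · exact Manifold.IsSubmersionOfComplement.isSubmersion (F := PUnit.{1}) fun x => hM.elim x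
  have := LinearMap.finrank_le_finrank_of_surjective (f := (mderiv I J f x : E →ₗ[ℝ] E')) (h x)
  exact Manifold.IsSubmersionOfComplement.isSubmersion fun x =>
    isSubmersionAtOfComplement_of_surjective_mderiv hf.smooth (Nat.add_sub_of_le this).symm (h x)

end NormalForms

/-! ### Descent of smoothness along maps with local sections. -/

section Sections

variable {E H M E' H' N E'' H'' Q E₂ H₂ M₂ E₂' H₂' N₂ : Type*} [NormedAddCommGroup E]
  [NormedSpace ℝ E] [TopologicalSpace H] [TopologicalSpace M] [ChartedSpace H M]
  {I : ModelWithCorners ℝ E H} [NormedAddCommGroup E'] [NormedSpace ℝ E']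
  [TopologicalSpace H'] [TopologicalSpace N] [ChartedSpace H' N] {J : ModelWithCorners ℝ E' H'}
  [NormedAddCommGroup E''] [NormedSpace ℝ E'']
  [TopologicalSpace H''] [TopologicalSpace Q] [ChartedSpace H'' Q]
  {K : ModelWithCorners ℝ E'' H''} [NormedAddCommGroup E₂]
  [NormedSpace ℝ E₂] [TopologicalSpace H₂] [TopologicalSpace M₂] [ChartedSpace H₂ M₂]
  {I₂ : ModelWithCorners ℝ E₂ H₂} [NormedAddCommGroup E₂'] [NormedSpace ℝ E₂']
  [TopologicalSpace H₂'] {J₂ : ModelWithCorners ℝ E₂' H₂'}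
  [TopologicalSpace N₂] [ChartedSpace H₂' N₂]

/-- Smoothness can be tested after composition with a surjection with local sections. -/
lemma HasLocalSections.contMDiff_of_comp {f : M → N} (hf : HasLocalSections I J f)
    (hs : Function.Surjective f) {g : N → Q} (hg : ContMDiff I K ∞ fun x => g (f x)) :
    ContMDiff J K ∞ g := by
  intro y
  obtain ⟨x, rfl⟩ := hs y
  obtain ⟨σ, hσ, -, hsec⟩ := hf.exists_section x
  refine (hg.contMDiffAt.comp (f x) hσ).congr_of_eventuallyEq ?_
  filter_upwards [hsec] with y hy
  simp only [Function.comp_apply, hy]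

/-- A section of `g ∘ f`, followed by `f`, is a section of `g`; surjectivity of `f` lets it pass
through any prescribed point. -/
lemma HasLocalSections.of_comp {f : M → N} (hf : ContMDiff I J ∞ f) (hs : Function.Surjective f)
    {g : N → Q} (hg : ContMDiff J K ∞ g) (hgf : HasLocalSections I K fun x => g (f x)) :
    HasLocalSections J K g := by
  refine ⟨hg, fun y => ?_⟩
  obtain ⟨x, rfl⟩ := hs y
  obtain ⟨σ, hσ, hx, hsec⟩ := hgf.exists_section x
  exact ⟨fun z => f (σ z), hf.contMDiffAt.comp (g (f x)) hσ, congrArg f hx, hsec⟩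

lemma HasLocalSections.prodMap {f : M → N} {g : M₂ → N₂} (hf : HasLocalSections I J f)
    (hg : HasLocalSections I₂ J₂ g) :
    HasLocalSections (I.prod I₂) (J.prod J₂) (Prod.map f g) := by
  refine ⟨hf.smooth.prodMap hg.smooth, fun x => ?_⟩
  obtain ⟨σ, hσ, hx, hsec⟩ := hf.exists_section x.1
  obtain ⟨τ, hτ, hy, tsec⟩ := hg.exists_section x.2
  refine ⟨Prod.map σ τ, ContMDiffAt.prodMap hσ hτ, Prod.ext hx hy, ?_⟩
  have : ∀ᶠ y in 𝓝 (f x.1) ×ˢ 𝓝 (g x.2), Prod.map f g (Prod.map σ τ y) = y :=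
    (hsec.prod_mk tsec).mono fun y hy => Prod.ext hy.1 hy.2
  rwa [← nhds_prod_eq] at this

end Sections

/-! ### Smooth structures on quotients from local slices. -/

section Quotient

variable {E H X Y : Type*} [NormedAddCommGroup E] [NormedSpace ℝ E]
  [TopologicalSpace H] [TopologicalSpace X] [ChartedSpace H X] {I : ModelWithCorners ℝ E H}

/-- A local slice of dimension `r` of a map `q : X → Y`: a submersion `s` on `U` together with a
section `σ` whose image meets each fibre of `q` at most once. -/
structure Slice (I : ModelWithCorners ℝ E H) (q : X → Y) (r : ℕ) where
  U : Set X
  B : Set (EuclideanSpace ℝ (Fin r))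
  s : X → EuclideanSpace ℝ (Fin r)
  σ : EuclideanSpace ℝ (Fin r) → X
  isOpen_U : IsOpen U
  isOpen_B : IsOpen B
  mapsTo_s : MapsTo s U B
  mapsTo_σ : MapsTo σ B U
  smooth_s : ContMDiffOn I (𝓡 r) ∞ s U
  smooth_σ : ContMDiffOn (𝓡 r) I ∞ σ B
  s_σ : ∀ e ∈ B, s (σ e) = e
  q_σ_s : ∀ x ∈ U, q (σ (s x)) = q x
  injOn : InjOn (fun e => q (σ e)) B

/-- The fibres of `q` are homogeneous under smooth maps that preserve `q`. -/
def HasHomogeneousFibers (I : ModelWithCorners ℝ E H) (q : X → Y) : Prop :=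
  ∀ a b, q a = q b → ∃ φ : X → X, ContMDiff I I ∞ φ ∧ φ a = b ∧ ∀ x, q (φ x) = q x

variable {r : ℕ} {q : X → Y}

lemma Slice.image_eq (S : Slice I q r) : (fun e => q (S.σ e)) '' S.B = q '' S.U := by
  ext y
  constructor
  · rintro ⟨e, he, rfl⟩
    exact ⟨_, S.mapsTo_σ he, rfl⟩
  · rintro ⟨x, hx, rfl⟩
    exact ⟨_, S.mapsTo_s hx, S.q_σ_s x hx⟩

variable [TopologicalSpace Y]

/-- If `x` lies in the fibre of `w ∈ W` and `φ` carries `x` to `w`, then the open set `φ ⁻¹' W`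
around `x` lies in the saturation of `W`. -/
lemma HasHomogeneousFibers.isOpenMap (h : HasHomogeneousFibers I q)
    (hq : Topology.IsQuotientMap q) : IsOpenMap q := by
  intro W hW
  rw [← hq.isOpen_preimage, isOpen_iff_mem_nhds]
  rintro x ⟨w, hw, hwx⟩
  obtain ⟨φ, hφ, hφx, hφq⟩ := h x w hwx.symm
  filter_upwards [(hW.preimage hφ.continuous).mem_nhds (show φ x ∈ W by rwa [hφx])] with z hz
  exact ⟨φ z, hz, hφq z⟩

/-- The chart of `Y` given by a slice. -/
noncomputable def Slice.chart (S : Slice I q r) (hc : Continuous q) (ho : IsOpenMap q) :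
    OpenPartialHomeomorph Y (EuclideanSpace ℝ (Fin r)) :=
  (OpenPartialHomeomorph.ofContinuousOpenRestrict
    (S.injOn.toPartialEquiv (fun e => q (S.σ e)) S.B)
    (hc.comp_continuousOn S.smooth_σ.continuousOn)
    (by
      intro W hW
      have hV : IsOpen (Subtype.val '' W) := S.isOpen_B.isOpenMap_subtype_val W hW
      -- The image of `W` under `q ∘ σ` is also the image under `q` of an open set, namely of the
      -- preimage of `W` under `s`.
      have hV' := ho _ (S.smooth_s.continuousOn.isOpen_inter_preimage S.isOpen_U hV)
      convert hV' using 1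
      ext y
      constructor
      · rintro ⟨⟨e, he⟩, heW, rfl⟩
        exact ⟨S.σ e, ⟨S.mapsTo_σ he, by rw [mem_preimage, S.s_σ e he]; exact ⟨_, heW, rfl⟩⟩, rfl⟩
      · rintro ⟨x, ⟨hx, ⟨e, heW, hes⟩⟩, rfl⟩
        refine ⟨e, heW, ?_⟩
        change q (S.σ e) = q x
        rw [hes, S.q_σ_s x hx])
    S.isOpen_B).symm

variable (S : Slice I q r) (hc : Continuous q) (ho : IsOpenMap q)

lemma Slice.chart_source : (S.chart hc ho).source = q '' S.U := S.image_eq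

lemma Slice.chart_apply {x : X} (hx : x ∈ S.U) : S.chart hc ho (q x) = S.s x := by
  rw [← S.q_σ_s x hx]
  exact (S.chart hc ho).right_inv (S.mapsTo_s hx)

/-- Two slices may meet the same fibre at distant points. A map `φ` preserving `q` carries the first
slice into the domain of the second near the given point, so locally the transition map is `T.s ∘ φ
∘ S.σ`. -/
lemma Slice.contDiffOn_transition (hhom : HasHomogeneousFibers I q) (T : Slice I q r) :
    ContDiffOn ℝ ∞ ((S.chart hc ho).symm.trans (T.chart hc ho))
      ((S.chart hc ho).symm.trans (T.chart hc ho)).source := by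
  rintro e ⟨he, heT⟩
  rw [mem_preimage, T.chart_source hc ho] at heT
  obtain ⟨x, hxT, hx⟩ := heT
  obtain ⟨φ, hφ, hφx, hφq⟩ := hhom (S.σ e) x hx.symm
  have hσ : ContMDiffAt (𝓡 r) I ∞ S.σ e := S.smooth_σ.contMDiffAt (S.isOpen_B.mem_nhds he)
  have hφσ : ContMDiffAt (𝓡 r) I ∞ (fun e => φ (S.σ e)) e := hφ.contMDiffAt.comp e hσ
  have hs : ContMDiffAt I (𝓡 r) ∞ T.s (φ (S.σ e)) :=
    T.smooth_s.contMDiffAt (T.isOpen_U.mem_nhds (by rwa [hφx]))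
  have hcomp : ContMDiffAt (𝓡 r) (𝓡 r) ∞ (fun e => T.s (φ (S.σ e))) e := hs.comp e hφσ
  refine (ContDiffAt.congr_of_eventuallyEq hcomp.contDiffAt ?_).contDiffWithinAt
  filter_upwards [hφσ.continuousAt.preimage_mem_nhds
    (T.isOpen_U.mem_nhds (by rwa [hφx]))] with e' hmem
  change T.chart hc ho (q (S.σ e')) = _
  rw [← hφq, T.chart_apply hc ho hmem]

/-- A quotient with homogeneous fibres and enough slices is a manifold. -/
theorem exists_chartedSpace_of_slices (hq : Topology.IsQuotientMap q)
    (hhom : HasHomogeneousFibers I q) (hS : ∀ x, ∃ S : Slice I q r, x ∈ S.U) :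
    ∃ _ : ChartedSpace (EuclideanSpace ℝ (Fin r)) Y, IsManifold (𝓡 r) ∞ Y ∧
      HasLocalSections I (𝓡 r) q := by
  have hc := hq.continuous
  have ho := hhom.isOpenMap hq
  choose x hx using hq.surjective
  choose S hS using hS
  let cs : ChartedSpace (EuclideanSpace ℝ (Fin r)) Y :=
    { atlas := range fun S : Slice I q r => S.chart hc ho
      chartAt := fun y => (S (x y)).chart hc ho
      mem_chart_source := fun y => by
        rw [Slice.chart_source]
        exact ⟨x y, hS _, hx y⟩
      chart_mem_atlas := fun y => ⟨_, rfl⟩ }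
  have hman : IsManifold (𝓡 r) ∞ Y := by
    refine isManifold_of_contDiffOn _ _ _ ?_
    rintro _ _ ⟨S, rfl⟩ ⟨T, rfl⟩
    have := S.contDiffOn_transition hc ho hhom T
    simpa using this
  have hmem : ∀ S : Slice I q r, IsPartialDiffeo (𝓡 r) (𝓡 r) (S.chart hc ho) := fun S =>
    .of_mem_maximalAtlas (IsManifold.subset_maximalAtlas ⟨S, rfl⟩)
  refine ⟨cs, hman, fun z => ?_, fun z => ?_⟩
  · have h1 := (hmem (S z)).contMDiffAt_symm ((S z).mapsTo_s (hS z))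
    have h2 : ContMDiffAt I (𝓡 r) ∞ (S z).s z :=
      (S z).smooth_s.contMDiffAt ((S z).isOpen_U.mem_nhds (hS z))
    refine (h1.comp z h2).congr_of_eventuallyEq ?_
    filter_upwards [(S z).isOpen_U.mem_nhds (hS z)] with w hw
    exact ((S z).q_σ_s w hw).symm
  -- The section given by the slice passes through `σ (s z)` rather than `z`; composing with `φ`
  -- makes it pass through `z`.
  · obtain ⟨φ, hφ, hφz, hφq⟩ := hhom _ _ ((S z).q_σ_s z (hS z))
    have hsrc : q z ∈ ((S z).chart hc ho).source := by
      rw [Slice.chart_source]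
      exact ⟨z, hS z, rfl⟩
    have h1 := (hmem (S z)).contMDiffAt hsrc
    have h2 : ContMDiffAt (𝓡 r) I ∞ (S z).σ ((S z).chart hc ho (q z)) :=
      (S z).smooth_σ.contMDiffAt
        ((S z).isOpen_B.mem_nhds (((S z).chart hc ho).map_source hsrc))
    refine ⟨fun y => φ ((S z).σ ((S z).chart hc ho y)),
      hφ.contMDiffAt.comp (q z) (h2.comp (q z) h1), ?_, ?_⟩
    · simp only [(S z).chart_apply hc ho (hS z), hφz]
    · filter_upwards [((S z).chart hc ho).open_source.mem_nhds hsrc] with y hy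
      rw [hφq]
      exact ((S z).chart hc ho).left_inv hy

end Quotient

/-! ### Homogeneous maps: constant rank and slices. -/

section Homogeneous

variable {E H X Y E' H' Z : Type*} [NormedAddCommGroup E] [NormedSpace ℝ E]
  [TopologicalSpace H] [TopologicalSpace X] [ChartedSpace H X] {I : ModelWithCorners ℝ E H}
  [NormedAddCommGroup E'] [NormedSpace ℝ E'] [TopologicalSpace H'] [TopologicalSpace Z]
  {J : ModelWithCorners ℝ E' H'} [ChartedSpace H' Z]

/-- A map that is equivariant for a transitive family of smooth transformations of its source. -/
def IsHomogeneousMap (I : ModelWithCorners ℝ E H) (J : ModelWithCorners ℝ E' H') (f : X → Z) :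
    Prop :=
  ∀ a b, ∃ (φ : X → X) (ψ : Z → Z), ContMDiff I I ∞ φ ∧ ContMDiff J J ∞ ψ ∧ φ a = b ∧
    ∀ x, ψ (f (φ x)) = f x

lemma finrank_range_comp_comp_le [FiniteDimensional ℝ E'] (A : E →L[ℝ] E) (B : E' →L[ℝ] E')
    (D : E →L[ℝ] E') :
    Module.finrank ℝ (B ∘L D ∘L A).range ≤ Module.finrank ℝ D.range := by
  have h1 : (B ∘L D ∘L A).range ≤ D.range.map (B : E' →ₗ[ℝ] E') := by
    rintro _ ⟨u, rfl⟩
    exact ⟨_, ⟨A u, rfl⟩, rfl⟩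
  exact (Submodule.finrank_mono h1).trans (Submodule.finrank_map_le _ _)

/-- From `f = ψ ∘ f ∘ φ` the derivative at `a` factors through that at `φ a = b`, which bounds its
rank. Exchanging `a` and `b` gives equality without invertibility of `φ` or `ψ`. -/
lemma IsHomogeneousMap.finrank_range_mderiv_eq [FiniteDimensional ℝ E'] {f : X → Z}
    (hf : ContMDiff I J ∞ f) (hh : IsHomogeneousMap I J f) (a b : X) :
    Module.finrank ℝ (mderiv I J f a).range = Module.finrank ℝ (mderiv I J f b).range := by
  have key : ∀ a b, Module.finrank ℝ (mderiv I J f a).range ≤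
      Module.finrank ℝ (mderiv I J f b).range := by
    intro a b
    obtain ⟨φ, ψ, hφ, hψ, rfl, h⟩ := hh a b
    have h1 : MDifferentiableAt I I φ a := hφ.contMDiffAt.mdifferentiableAt (by simp)
    have h2 : MDifferentiableAt I J f (φ a) := hf.contMDiffAt.mdifferentiableAt (by simp)
    have h3 : MDifferentiableAt J J ψ (f (φ a)) := hψ.contMDiffAt.mdifferentiableAt (by simp)
    have h4 : mderiv I J f a = mderiv J J ψ (f (φ a)) ∘L mderiv I J f (φ a) ∘L mderiv I I φ a := by
      rw [← mderiv_comp h2 h1, ← mderiv_comp (f := fun x => f (φ x)) h3 (h2.comp a h1)]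
      exact congrArg (fun g => mderiv I J g a) (funext fun x => (h x).symm)
    rw [h4]
    exact finrank_range_comp_comp_le _ _ _
  exact le_antisymm (key a b) (key b a)

variable [FiniteDimensional ℝ E] [FiniteDimensional ℝ E'] [I.Boundaryless] [J.Boundaryless]
  [IsManifold I ∞ X] [IsManifold J ∞ Z]

/-- The rank is read off at a fixed `x₀`, so that the charts at all points `x` have the same model
space. -/
lemma IsHomogeneousMap.exists_straightening {f : X → Z} (hf : ContMDiff I J ∞ f)
    (hh : IsHomogeneousMap I J f) (x₀ x : X) :
    ∃ e : OpenPartialHomeomorph X (EuclideanSpace ℝ (Fin (Module.finrank ℝ (mderiv I J f x₀).range))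
        × EuclideanSpace ℝ (Fin (Module.finrank ℝ E - Module.finrank ℝ (mderiv I J f x₀).range))),
      x ∈ e.source ∧
      IsPartialDiffeo I 𝓘(ℝ, EuclideanSpace ℝ (Fin (Module.finrank ℝ (mderiv I J f x₀).range))
        × EuclideanSpace ℝ (Fin (Module.finrank ℝ E - Module.finrank ℝ (mderiv I J f x₀).range))) e ∧
      ∀ a ∈ e.source, ∀ b ∈ e.source, (e a).1 = (e b).1 ↔ f a = f b :=
  exists_straightening_of_finrank_range_mderiv hf
    (fun y => hh.finrank_range_mderiv_eq hf y x₀)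
    (Nat.add_sub_of_le (LinearMap.finrank_range_le (mderiv I J f x₀ : E →ₗ[ℝ] E'))).symm x

/-- An injective homogeneous map has injective derivatives. -/
lemma IsHomogeneousMap.injective_mderiv {f : X → Z} (hf : ContMDiff I J ∞ f)
    (hh : IsHomogeneousMap I J f) (hinj : Function.Injective f) (x : X) :
    Function.Injective (mderiv I J f x) := by
  obtain ⟨e, hx, he, hfib⟩ := hh.exists_straightening hf x x
  -- A positive fibre dimension would provide points different from `x` in the straightened fibre of
  -- `f` through `x`, against injectivity.
  have hd0 : Module.finrank ℝ E - Module.finrank ℝ (mderiv I J f x).range = 0 := by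
    by_contra hne
    have := Fin.pos_iff_nonempty.1 (Nat.pos_of_ne_zero hne)
    have hmem : ∀ᶠ c in 𝓝[≠] (e x).2, ((e x).1, c) ∈ e.target := by
      refine Filter.Eventually.filter_mono nhdsWithin_le_nhds ?_
      exact (Continuous.continuousAt (by fun_prop :
        Continuous fun c => ((e x).1, c))).preimage_mem_nhds
          (e.open_target.mem_nhds (e.map_source hx))
    obtain ⟨c, hc, hne⟩ := (hmem.and self_mem_nhdsWithin).exists
    have h1 : f (e.symm ((e x).1, c)) = f x := by
      rw [← hfib _ (e.map_target hc) _ hx, e.right_inv hc]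
    have h2 := congrArg e (hinj h1)
    rw [e.right_inv hc] at h2
    exact hne (congrArg Prod.snd h2)
  have h1 := LinearMap.finrank_range_add_finrank_ker (mderiv I J f x : E →ₗ[ℝ] E')
  have h2 : Module.finrank ℝ (LinearMap.ker (mderiv I J f x : E →ₗ[ℝ] E')) = 0 := by omega
  exact LinearMap.ker_eq_bot.1 (Submodule.finrank_eq_zero.1 h2)

/-- A homogeneous map provides slices for each map with the same fibres. -/
lemma IsHomogeneousMap.exists_slice {f : X → Z} (hf : ContMDiff I J ∞ f)
    (hh : IsHomogeneousMap I J f) {q : X → Y} (hq : ∀ a b, f a = f b ↔ q a = q b) (x₀ x : X) :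
    ∃ S : Slice I q (Module.finrank ℝ (mderiv I J f x₀).range), x ∈ S.U := by
  obtain ⟨e, hx, he, hfib⟩ := hh.exists_straightening hf x₀ x
  generalize Module.finrank ℝ E - Module.finrank ℝ (mderiv I J f x₀).range = d at *
  generalize Module.finrank ℝ (mderiv I J f x₀).range = r at *
  have hB : IsOpen {v | (v, (e x).2) ∈ e.target} := e.open_target.preimage (by fun_prop)
  have hmk : ContDiff ℝ ∞ fun v : EuclideanSpace ℝ (Fin r) => (v, (e x).2) := by fun_prop
  have hs : ContMDiffOn I (𝓡 r) ∞ (fun y => (e y).1) e.source :=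
    contDiff_fst.contMDiff.comp_contMDiffOn he.smooth
  refine ⟨⟨e.source ∩ (fun y => (e y).1) ⁻¹' {v | (v, (e x).2) ∈ e.target},
    {v | (v, (e x).2) ∈ e.target}, fun y => (e y).1, fun v => e.symm (v, (e x).2),
    hs.continuousOn.isOpen_inter_preimage e.open_source hB, hB, fun y hy => hy.2,
    fun v hv => ⟨e.map_target hv, ?_⟩, hs.mono inter_subset_left,
    he.smooth_symm.comp hmk.contMDiff.contMDiffOn (fun v hv => hv), fun v hv => ?_,
    fun y hy => ?_, fun v hv w hw hvw => ?_⟩, hx, ?_⟩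
  · rw [mem_preimage, e.right_inv hv]
    exact hv
  · rw [e.right_inv hv]
  · rw [← hq, ← hfib _ (e.map_target hy.2) _ hy.1, e.right_inv hy.2]
  · have h1 := (hfib _ (e.map_target hv) _ (e.map_target hw)).2 ((hq _ _).2 hvw)
    rwa [e.right_inv hv, e.right_inv hw] at h1
  · exact e.map_source hx

/-- The quotient of a manifold by the fibres of a homogeneous map is a manifold. -/
theorem IsHomogeneousMap.exists_chartedSpace [Nonempty X] [TopologicalSpace Y] {f : X → Z}
    (hf : ContMDiff I J ∞ f) (hh : IsHomogeneousMap I J f) {q : X → Y}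
    (hq : ∀ a b, f a = f b ↔ q a = q b) (hquot : Topology.IsQuotientMap q)
    (hhom : HasHomogeneousFibers I q) :
    ∃ (r : ℕ) (_ : ChartedSpace (EuclideanSpace ℝ (Fin r)) Y), IsManifold (𝓡 r) ∞ Y ∧
      HasLocalSections I (𝓡 r) q :=
  ⟨_, exists_chartedSpace_of_slices hquot hhom (hh.exists_slice hf hq (Classical.arbitrary X))⟩

end Homogeneous

/-! ### Orbits and free actions. -/

section FreeAction

variable {G X : Type*} [Group G] [MulAction G X]

lemma proj_eq_proj_iff {x y : X} : proj G x = proj G y ↔ ∃ g : G, g • x = y := by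
  rw [eq_comm]
  exact Quotient.eq''

lemma proj_smul (g : G) (x : X) : proj G (g • x) = proj G x :=
  (proj_eq_proj_iff.2 ⟨g, rfl⟩).symm

lemma smul_left_injective_of_free (hfree : ∀ (g : G) (x : X), g • x = x → g = 1) (x : X) :
    Function.Injective fun g : G => g • x := by
  intro a b hab
  have h1 : (b⁻¹ * a) • x = x := by
    rw [mul_smul, show a • x = b • x from hab, inv_smul_smul]
  exact (inv_mul_eq_one.1 (hfree _ _ h1)).symm

end FreeAction

/-! ### Slices for principal actions. -/

section Action

variable {n m : ℕ} {P : Type*} [TopologicalSpace P] [ChartedSpace (EuclideanSpace ℝ (Fin n)) P]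
  {G : Type*} [Group G] [TopologicalSpace G] [ChartedSpace (EuclideanSpace ℝ (Fin m)) G]
  [MulAction G P]

lemma ContMDiffSMul.contMDiff_smul_const (h : ContMDiffSMul (𝓡 m) (𝓡 n) ∞ G P) (p : P) :
    ContMDiff (𝓡 m) (𝓡 n) ∞ fun g : G => g • p :=
  h.contMDiff_smul.comp (contMDiff_id.prodMk contMDiff_const)

lemma ContMDiffSMul.contMDiff_const_smul' (h : ContMDiffSMul (𝓡 m) (𝓡 n) ∞ G P) (g : G) :
    ContMDiff (𝓡 n) (𝓡 n) ∞ fun p : P => g • p :=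
  h.contMDiff_smul.comp (contMDiff_const.prodMk contMDiff_id)

lemma ContMDiffSMul.isHomogeneousMap_smul_const [LieGroup (𝓡 m) ∞ G]
    (h : ContMDiffSMul (𝓡 m) (𝓡 n) ∞ G P) (p : P) :
    IsHomogeneousMap (𝓡 m) (𝓡 n) fun g : G => g • p := by
  intro a b
  refine ⟨fun g => b * a⁻¹ * g, fun y => (b * a⁻¹)⁻¹ • y, contMDiff_mul_left,
    h.contMDiff_const_smul' _, by simp, fun g => ?_⟩
  simp only [mul_smul, mul_inv_rev, inv_inv, smul_inv_smul, inv_smul_smul]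

lemma ContMDiffSMul.hasHomogeneousFibers_proj (h : ContMDiffSMul (𝓡 m) (𝓡 n) ∞ G P) :
    HasHomogeneousFibers (𝓡 n) (proj G : P → MulAction.orbitRel.Quotient G P) := by
  intro a b hab
  obtain ⟨g, rfl⟩ := proj_eq_proj_iff.1 hab
  exact ⟨fun y => g • y, h.contMDiff_const_smul' g, rfl, proj_smul g⟩

variable [IsManifold (𝓡 n) ∞ P] [LieGroup (𝓡 m) ∞ G]

/-- Freeness makes the orbit map injective and equivariance gives it constant rank, so it is an
immersion; no Lie algebra argument is needed. -/
lemma injective_mderiv_smul_const (h : ContMDiffSMul (𝓡 m) (𝓡 n) ∞ G P)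
    (hfree : ∀ (g : G) (x : P), g • x = x → g = 1) (p : P) (g : G) :
    Function.Injective (mderiv (𝓡 m) (𝓡 n) (fun g : G => g • p) g) :=
  (h.isHomogeneousMap_smul_const p).injective_mderiv (h.contMDiff_smul_const p)
    (smul_left_injective_of_free hfree p) g

lemma mderiv_prod_eq_coprod {E₁ H₁ M₁ E₂ H₂ M₂ E H N : Type*} [NormedAddCommGroup E₁]
    [NormedSpace ℝ E₁] [TopologicalSpace H₁] [TopologicalSpace M₁] [ChartedSpace H₁ M₁]
    {I₁ : ModelWithCorners ℝ E₁ H₁} [NormedAddCommGroup E₂] [NormedSpace ℝ E₂] [TopologicalSpace H₂]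
    [TopologicalSpace M₂] [ChartedSpace H₂ M₂] {I₂ : ModelWithCorners ℝ E₂ H₂}
    [NormedAddCommGroup E] [NormedSpace ℝ E] [TopologicalSpace H]
    [TopologicalSpace N] [ChartedSpace H N] {J : ModelWithCorners ℝ E H} {f : M₁ × M₂ → N}
    {a : M₁} {b : M₂} (hf : MDifferentiableAt (I₁.prod I₂) J f (a, b)) :
    mderiv (I₁.prod I₂) J f (a, b) =
      (mderiv I₁ J (fun x => f (x, b)) a).coprod (mderiv I₂ J (fun y => f (a, y)) b) := by
  refine ContinuousLinearMap.ext fun v => ?_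
  exact mfderiv_prod_eq_add_apply hf

/-- A smooth family of points through `p` with prescribed derivative. -/
lemma exists_contMDiffOn_mderiv_eq {k : ℕ} (p : P)
    (B : EuclideanSpace ℝ (Fin k) →L[ℝ] EuclideanSpace ℝ (Fin n)) :
    ∃ (W : Set (EuclideanSpace ℝ (Fin k))) (σ : EuclideanSpace ℝ (Fin k) → P), IsOpen W ∧ 0 ∈ W ∧
      ContMDiffOn (𝓡 k) (𝓡 n) ∞ σ W ∧ σ 0 = p ∧ mderiv (𝓡 k) (𝓡 n) σ 0 = B := by
  let χ := modelChart (𝓡 n) p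
  have hp : p ∈ χ.source := mem_modelChart_source p
  have hχ : IsPartialDiffeo (𝓡 n) (𝓡 n) χ := isPartialDiffeo_modelChart p
  have hTχ := mderiv_comp_eq_id (f := χ) (g := χ.symm) (x := p)
    ((hχ.contMDiffAt_symm (χ.map_source hp)).mdifferentiableAt (by simp))
    ((hχ.contMDiffAt hp).mdifferentiableAt (by simp)) (χ.eventually_left_inverse hp)
  -- The map `C` is `B` read in the chart `χ`; the family is the image of the affine map `χ p + C e`
  -- under the inverse chart.
  let C := mderiv (𝓡 n) (𝓡 n) χ p ∘L B
  have hlin : ContMDiff (𝓡 k) (𝓡 n) ∞ fun e => χ p + C e :=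
    ContDiff.contMDiff (by fun_prop)
  have h0 : χ p + C 0 ∈ χ.target := by
    rw [map_zero, add_zero]; exact χ.map_source hp
  refine ⟨(fun e => χ p + C e) ⁻¹' χ.target, fun e => χ.symm (χ p + C e),
    χ.open_target.preimage hlin.continuous, h0,
    hχ.smooth_symm.comp hlin.contMDiffOn (fun e he => he), by simp [χ.left_inv hp], ?_⟩
  have e3 : mderiv (𝓡 k) (𝓡 n) (fun e => χ p + C e) 0 = C := by
    rw [mderiv_eq_fderiv, fderiv_const_add, C.fderiv]
  rw [mderiv_comp (I := 𝓡 k) (J := 𝓡 n) (K := 𝓡 n) (g := χ.symm) (f := fun e => χ p + C e)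
    (x := 0) ((hχ.contMDiffAt_symm h0).mdifferentiableAt (by simp))
    (hlin.contMDiffAt.mdifferentiableAt (by simp)), e3, map_zero, add_zero]
  exact ContinuousLinearMap.ext fun v => hTχ (B v)

/-- Near a point, a free action is the translation of a transversal. -/
lemma exists_transversal (h : ContMDiffSMul (𝓡 m) (𝓡 n) ∞ G P)
    (hfree : ∀ (g : G) (x : P), g • x = x → g = 1) {k : ℕ} (hk : n = m + k) (p : P) :
    ∃ (W : Set (EuclideanSpace ℝ (Fin k))) (σ : EuclideanSpace ℝ (Fin k) → P)
      (e : OpenPartialHomeomorph (G × EuclideanSpace ℝ (Fin k)) P), IsOpen W ∧ 0 ∈ W ∧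
      ContMDiffOn (𝓡 k) (𝓡 n) ∞ σ W ∧ σ 0 = p ∧ ((1 : G), 0) ∈ e.source ∧
      (∀ z ∈ e.source, e z = z.1 • σ z.2) ∧ IsPartialDiffeo ((𝓡 m).prod (𝓡 k)) (𝓡 n) e := by
  obtain ⟨B, hB⟩ := exists_complement_of_injective
    (mderiv (𝓡 m) (𝓡 n) (fun g : G => g • p) 1)
    (injective_mderiv_smul_const h hfree p 1) (d := k) (by simp [hk])
  obtain ⟨W, σ, hW, h0W, hσ, hσ0, hσB⟩ := exists_contMDiffOn_mderiv_eq p B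
  have hΨ : ContMDiffOn ((𝓡 m).prod (𝓡 k)) (𝓡 n) ∞
      (fun z : G × EuclideanSpace ℝ (Fin k) => z.1 • σ z.2) (Prod.snd ⁻¹' W) :=
    h.contMDiff_smul.comp_contMDiffOn (contMDiff_fst.contMDiffOn.prodMk
      (hσ.comp contMDiff_snd.contMDiffOn fun z hz => hz))
  have hWo : IsOpen (Prod.snd ⁻¹' W : Set (G × EuclideanSpace ℝ (Fin k))) :=
    hW.preimage continuous_snd
  have hΨ' : mderiv ((𝓡 m).prod (𝓡 k)) (𝓡 n)
      (fun z : G × EuclideanSpace ℝ (Fin k) => z.1 • σ z.2) (1, 0) =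
      (mderiv (𝓡 m) (𝓡 n) (fun g : G => g • p) 1).coprod B := by
    rw [mderiv_prod_eq_coprod ((hΨ.contMDiffAt (hWo.mem_nhds h0W)).mdifferentiableAt (by simp))]
    simp only [hσ0, one_smul]
    rw [hσB]
  obtain ⟨e, he0, -, heq, he⟩ := exists_isPartialDiffeo_of_bijective_mderiv hWo
    (show ((1 : G), (0 : EuclideanSpace ℝ (Fin k))) ∈ _ from h0W) hΨ
    (by rw [hΨ']; exact hB)
  exact ⟨W, σ, e, hW, h0W, hσ, hσ0, he0, heq, he⟩

/-- By freeness the fibre of `(g, x) ↦ (g x, x)` over `(p, p)` is the single point `(1, p)`. As this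
map is closed, preimages of small neighbourhoods of `(p, p)` shrink to that point: only group
elements near `1` can return a point near `p` to a neighbourhood of `p`. -/
lemma DoublePrincipal.IsPrincipalAction.exists_nhds {G X : Type*} [Group G] [TopologicalSpace G]
    [TopologicalSpace X] [MulAction G X] (hG : IsPrincipalAction G X) (p : X) {V : Set G}
    (hV : V ∈ 𝓝 1) : ∃ O ∈ 𝓝 p, ∀ x ∈ O, ∀ g : G, g • x ∈ O → g ∈ V := by
  have h1 := hG.proper.isProperMap_smul_pair.isClosedMap.comap_nhds_le (y := (p, p))
  have h2 : (fun gx : G × X => (gx.1 • gx.2, gx.2)) ⁻¹' {(p, p)} = {(1, p)} := by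
    ext ⟨g, x⟩
    simp only [mem_preimage, mem_singleton_iff, Prod.mk.injEq]
    constructor
    · rintro ⟨hg, rfl⟩
      exact ⟨hG.free g _ hg, rfl⟩
    · rintro ⟨rfl, rfl⟩
      simp
  rw [h2, nhdsSet_singleton] at h1
  obtain ⟨O, hO, hO'⟩ := h1 (continuousAt_fst.preimage_mem_nhds hV)
  obtain ⟨O₁, hO₁, O₂, hO₂, hOO⟩ := mem_nhds_prod_iff.1 hO
  exact ⟨O₁ ∩ O₂, Filter.inter_mem hO₁ hO₂, fun x hx g hg =>
    @hO' (g, x) (hOO ⟨hg.1, hx.2⟩)⟩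

/-- Slices for a free and proper smooth action. The map `v` translates the slice to the points of
its neighbourhood. -/
theorem exists_slice_of_isPrincipalAction (h : ContMDiffSMul (𝓡 m) (𝓡 n) ∞ G P)
    (hG : IsPrincipalAction G P) {k : ℕ} (hk : n = m + k) (p : P) :
    ∃ (S : Slice (𝓡 n) (proj G : P → MulAction.orbitRel.Quotient G P) k) (v : P → G),
      p ∈ S.U ∧ ContMDiffOn (𝓡 n) (𝓡 m) ∞ v S.U ∧ ∀ y ∈ S.U, v y • S.σ (S.s y) = y := by
  obtain ⟨W, σ, e, hW, h0W, hσ, hσ0, he0, heq, he⟩ := exists_transversal h hG.free hk p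
  obtain ⟨V, hV, B₁, hB₁, hVB⟩ := mem_nhds_prod_iff.1 (e.open_source.mem_nhds he0)
  obtain ⟨O, hO, hOV⟩ := hG.exists_nhds p hV
  have h1V : (1 : G) ∈ V := mem_of_mem_nhds hV
  -- Besides fitting the domain of `e`, `B` is so small that `σ` maps it into `O`. Two of its points
  -- with the same orbit then differ by an element of `V`, where injectivity of `e` identifies them.
  obtain ⟨B, hBsub, hB, h0B⟩ := mem_nhds_iff.1 (Filter.inter_mem (Filter.inter_mem hB₁
    (hW.mem_nhds h0W)) ((hσ.continuousOn.continuousAt (hW.mem_nhds h0W)).preimage_mem_nhds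
      (by rwa [hσ0])))
  have hval : ∀ g ∈ V, ∀ b ∈ B, (g, b) ∈ e.source ∧ e (g, b) = g • σ b := fun g hg b hb =>
    ⟨hVB ⟨hg, (hBsub hb).1.1⟩, heq _ (hVB ⟨hg, (hBsub hb).1.1⟩)⟩
  have hval1 : ∀ b ∈ B, σ b ∈ e.target ∧ e.symm (σ b) = (1, b) := by
    intro b hb
    obtain ⟨h1, h2⟩ := hval 1 h1V b hb
    rw [one_smul] at h2
    exact ⟨h2 ▸ e.map_source h1, by rw [← h2, e.left_inv h1]⟩
  have hs : ContMDiffOn (𝓡 n) (𝓡 k) ∞ (fun y => (e.symm y).2) e.target :=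
    contMDiff_snd.comp_contMDiffOn he.smooth_symm
  have hsymm : ∀ y ∈ e.target, (e.symm y).1 • σ (e.symm y).2 = y := fun y hy => by
    rw [← heq _ (e.map_target hy), e.right_inv hy]
  refine ⟨⟨e.target ∩ (fun y => (e.symm y).2) ⁻¹' B, B, fun y => (e.symm y).2, σ,
    hs.continuousOn.isOpen_inter_preimage e.open_target hB, hB, fun y hy => hy.2,
    fun b hb => ⟨(hval1 b hb).1, ?_⟩, hs.mono inter_subset_left,
    hσ.mono fun b hb => (hBsub hb).1.2, fun b hb => by rw [(hval1 b hb).2], fun y hy => ?_,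
    fun a ha b hb hab => ?_⟩, fun y => (e.symm y).1, ?_, ?_, ?_⟩
  · rw [mem_preimage, (hval1 b hb).2]
    exact hb
  · exact proj_eq_proj_iff.2 ⟨_, hsymm y hy.1⟩
  · obtain ⟨g, hg⟩ := proj_eq_proj_iff.1 hab
    have hgV : g ∈ V := hOV _ (hBsub ha).2 g (by rw [hg]; exact (hBsub hb).2)
    have h1 := hval g hgV a ha
    have h2 := hval 1 h1V b hb
    have h3 := e.injOn h1.1 h2.1 (by rw [h1.2, h2.2, one_smul, hg])
    exact congrArg Prod.snd h3
  · have h1 := hval1 0 h0B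
    rw [hσ0] at h1
    refine ⟨h1.1, ?_⟩
    rw [mem_preimage, h1.2]
    exact h0B
  · exact (contMDiff_fst.comp_contMDiffOn he.smooth_symm).mono inter_subset_left
  · exact fun y hy => hsymm y hy.1

end Action

/-! ### Orbit spaces and the division map of a principal action. -/

section Action

variable {n m : ℕ} {P : Type*} [TopologicalSpace P] [ChartedSpace (EuclideanSpace ℝ (Fin n)) P]
  {G : Type*} [Group G] [TopologicalSpace G] [ChartedSpace (EuclideanSpace ℝ (Fin m)) G]
  [MulAction G P] [IsManifold (𝓡 n) ∞ P]

lemma surjective_proj {G X : Type*} [Group G] [MulAction G X] :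
    Function.Surjective (proj G : X → MulAction.orbitRel.Quotient G X) :=
  Quotient.mk_surjective

/-- The orbit map of a principal action is a principal bundle. -/
lemma isPrincipalBundle_proj [T2Space P] [SecondCountableTopology P] (hL : IsLie m G)
    (h : ContMDiffSMul (𝓡 m) (𝓡 n) ∞ G P) (hG : IsPrincipalAction G P) {b : ℕ}
    [ChartedSpace (EuclideanSpace ℝ (Fin b)) (MulAction.orbitRel.Quotient G P)]
    [IsManifold (𝓡 b) ∞ (MulAction.orbitRel.Quotient G P)]
    (hs : HasLocalSections (𝓡 n) (𝓡 b) (proj G : P → MulAction.orbitRel.Quotient G P)) :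
    IsPrincipalBundle m n b G (proj G : P → MulAction.orbitRel.Quotient G P) where
  group := hL
  total := ⟨inferInstance, inferInstance, inferInstance⟩
  base := by
    have := hG.proper
    exact ⟨inferInstance, t2Space_quotient_mulAction_of_properSMul,
      ContinuousConstSMul.secondCountableTopology⟩
  smooth := h
  principal := hG
  surjective := surjective_proj
  submersion := hs.isSubmersion
  fiber _ _ := proj_eq_proj_iff

variable [LieGroup (𝓡 m) ∞ G]

lemma exists_eq_add_of_isPrincipalAction [Nonempty P] (h : ContMDiffSMul (𝓡 m) (𝓡 n) ∞ G P)
    (hG : IsPrincipalAction G P) : ∃ k, n = m + k := by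
  obtain ⟨p⟩ := ‹Nonempty P›
  have := LinearMap.finrank_le_finrank_of_injective
    (f := (mderiv (𝓡 m) (𝓡 n) (fun g : G => g • p) 1 :
      EuclideanSpace ℝ (Fin m) →ₗ[ℝ] EuclideanSpace ℝ (Fin n)))
    (injective_mderiv_smul_const h hG.free p 1)
  exact Nat.exists_eq_add_of_le (by simpa using this)

/-- The division map of a principal action is smooth. -/
lemma contMDiffAt_of_smul_eq {E H X : Type*} [NormedAddCommGroup E] [NormedSpace ℝ E]
    [TopologicalSpace H] [TopologicalSpace X] [ChartedSpace H X] {I : ModelWithCorners ℝ E H}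
    (h : ContMDiffSMul (𝓡 m) (𝓡 n) ∞ G P) (hG : IsPrincipalAction G P) {a b : X → P} {τ : X → G}
    {x : X} (ha : ContMDiffAt I (𝓡 n) ∞ a x) (hb : ContMDiffAt I (𝓡 n) ∞ b x)
    (hτ : ∀ y, τ y • a y = b y) : ContMDiffAt I (𝓡 m) ∞ τ x := by
  have : Nonempty P := ⟨a x⟩
  obtain ⟨k, hk⟩ := exists_eq_add_of_isPrincipalAction h hG
  obtain ⟨S, v, hp, hv, hvσ⟩ := exists_slice_of_isPrincipalAction h hG hk (a x)
  -- Translating `b` by the constant `(τ x)⁻¹` brings it near `a x`, into the same slice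
  -- neighbourhood as `a`. Near `x`, comparison of the two slice translations gives `τ y = τ x * v
  -- (c y) * (v (a y))⁻¹`.
  let c : X → P := fun y => (τ x)⁻¹ • b y
  have hc : ContMDiffAt I (𝓡 n) ∞ c x := (h.contMDiff_const_smul' _).contMDiffAt.comp x hb
  have hcx : c x = a x := by simp only [c, ← hτ, inv_smul_smul]
  have hva : ContMDiffAt I (𝓡 m) ∞ (fun y => v (a y)) x :=
    (hv.contMDiffAt (S.isOpen_U.mem_nhds hp)).comp x ha
  have hcU : S.U ∈ 𝓝 (c x) := by rw [hcx]; exact S.isOpen_U.mem_nhds hp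
  have hvc : ContMDiffAt I (𝓡 m) ∞ (fun y => v (c y)) x := (hv.contMDiffAt hcU).comp x hc
  have hprod : ContMDiffAt I (𝓡 m) ∞ (fun y => τ x * (v (c y) * (v (a y))⁻¹)) x :=
    contMDiffAt_const.mul (hvc.mul hva.inv)
  refine hprod.congr_of_eventuallyEq ?_
  filter_upwards [ha.continuousAt.preimage_mem_nhds (S.isOpen_U.mem_nhds hp),
    hc.continuousAt.preimage_mem_nhds hcU] with y hya hyc
  have hproj : proj G (S.σ (S.s (a y))) = proj G (S.σ (S.s (c y))) := by
    rw [S.q_σ_s _ hya, S.q_σ_s _ hyc]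
    refine proj_eq_proj_iff.2 ⟨(τ x)⁻¹ * τ y, ?_⟩
    simp only [mul_smul, hτ, c]
  have hs : S.s (a y) = S.s (c y) := S.injOn (S.mapsTo_s hya) (S.mapsTo_s hyc) hproj
  have h1 := hvσ _ hya
  have h2 := hvσ _ hyc
  rw [← hs] at h2
  have h3 : v (c y) = (τ x)⁻¹ * τ y * v (a y) := by
    refine smul_left_injective_of_free hG.free (S.σ (S.s (a y))) ?_
    simp only [mul_smul, h1, h2, hτ, c]
  rw [h3]
  group

/-- The orbit space of a principal action is a manifold. -/
theorem exists_chartedSpace_of_isPrincipalAction [Nonempty P]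
    (h : ContMDiffSMul (𝓡 m) (𝓡 n) ∞ G P) (hG : IsPrincipalAction G P) :
    ∃ (b : ℕ) (_ : ChartedSpace (EuclideanSpace ℝ (Fin b)) (MulAction.orbitRel.Quotient G P)),
      IsManifold (𝓡 b) ∞ (MulAction.orbitRel.Quotient G P) ∧
      HasLocalSections (𝓡 n) (𝓡 b) (proj G : P → MulAction.orbitRel.Quotient G P) := by
  obtain ⟨k, hk⟩ := exists_eq_add_of_isPrincipalAction h hG
  refine ⟨k, exists_chartedSpace_of_slices isQuotientMap_quotient_mk'
    h.hasHomogeneousFibers_proj fun p => ?_⟩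
  obtain ⟨S, v, hp, -⟩ := exists_slice_of_isPrincipalAction h hG hk p
  exact ⟨S, hp⟩

end Action

/-! ### The gauge groupoid: normalization, kernel, freeness and properness. -/

section Algebra

variable {G G' P : Type*} [Group G] [Group G'] [MulAction G P] [MulAction G' P]

lemma mem_inter_iff_exists_smul {g' : G'} :
    g' ∈ inter G' G P ↔ ∃ g : G, ∀ p : P, g • p = g' • p := by
  constructor
  · rintro ⟨g, hg⟩
    exact ⟨g, fun p => DFunLike.congr_fun hg p⟩
  · rintro ⟨g, hg⟩
    exact ⟨g, Equiv.ext hg⟩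

/-- If `G'` normalizes `G`, then `G'` modulo a group of transformations which preserve the
`G`-orbits acts on the orbit space. -/
lemma exists_mulAction_quotient {N : Subgroup G'} [N.Normal] {C : G' → G → G}
    (hC : ∀ g' g (p : P), g' • g • p = C g' g • g' • p)
    (hN : ∀ g' ∈ N, ∀ p : P, ∃ g : G, g • p = g' • p) :
    ∃ _ : MulAction (G' ⧸ N) (MulAction.orbitRel.Quotient G P),
      ∀ (g' : G') (p : P), (QuotientGroup.mk' N g') • proj G p = proj G (g' • p) := by
  let act : G' ⧸ N → MulAction.orbitRel.Quotient G P → MulAction.orbitRel.Quotient G P :=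
    Quotient.map₂ (fun g' p => g' • p) (by
      intro a b hab p p' hp
      obtain ⟨g, hg⟩ : ∃ g : G, g • p = p' := proj_eq_proj_iff.1 (Quotient.sound hp)
      obtain ⟨k, hk⟩ := hN _ (QuotientGroup.leftRel_apply.1 hab) p'
      -- Here `g` carries `p` to `p'` and `k` acts on `p'` as `a⁻¹ * b`, so `a • (k * g) • p = b •
      -- p'`; then `C` moves `k * g` past `a`.
      refine Quotient.exact (proj_eq_proj_iff.2 ⟨C a (k * g), ?_⟩)
      rw [← hC, mul_smul, hg, hk, mul_smul, smul_inv_smul])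
  refine ⟨{ smul := act, mul_smul := ?_, one_smul := ?_ }, fun _ _ => rfl⟩
  · rintro ⟨a⟩ ⟨b⟩ ⟨p⟩
    exact congrArg (proj G) (mul_smul a b p)
  · rintro ⟨p⟩
    exact congrArg (proj G) (one_smul G' p)

/-- An element fixing every `⟨p₀, p⟩` agrees at `p₀` and `p` with some element of `G`, a priori
depending on `p`. All these elements agree at `p₀`, so by freeness they coincide. -/
lemma ker_eq_inter [Nonempty P] [MulAction G' (Gauge G P)]
    (hact : ∀ (g' : G') (p q : P),
      g' • (proj G (p, q) : Gauge G P) = proj G (g' • p, g' • q))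
    (hfree : ∀ (g : G) (p : P), g • p = p → g = 1) :
    (MulAction.toPermHom G' (Gauge G P)).ker = inter G' G P := by
  obtain ⟨p₀⟩ := ‹Nonempty P›
  ext g'
  rw [mem_inter_iff_exists_smul, MonoidHom.mem_ker]
  constructor
  · intro hg'
    have h1 : ∀ p : P, ∃ g : G, g • p₀ = g' • p₀ ∧ g • p = g' • p := by
      intro p
      have h2 : g' • (proj G (p₀, p) : Gauge G P) = proj G (p₀, p) := DFunLike.congr_fun hg' _
      rw [hact] at h2
      obtain ⟨g, hg⟩ := proj_eq_proj_iff.1 h2.symm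
      exact ⟨g, congrArg Prod.fst hg, congrArg Prod.snd hg⟩
    choose k hk₀ hk using h1
    refine ⟨k p₀, fun p => ?_⟩
    rw [← hk, smul_left_injective_of_free hfree p₀ ((hk₀ p).trans (hk₀ p₀).symm)]
  · rintro ⟨g, hg⟩
    refine Equiv.ext ?_
    rintro ⟨p, q⟩
    change g' • (proj G (p, q) : Gauge G P) = proj G (p, q)
    rw [hact, ← hg, ← hg]
    exact proj_smul g (p, q)

variable [TopologicalSpace G'] [TopologicalSpace P]

/-- The group `G'` normalizes `G`. -/
lemma DoublePrincipal.IsRelPrincipal.exists_conj [Nonempty P] (h : IsRelPrincipal G G' P)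
    (hfree : ∀ (g : G) (p : P), g • p = p → g = 1) :
    ∃ C : G' → G → G, ∀ g' g (p : P), g' • g • p = C g' g • g' • p := by
  obtain ⟨_, hact, -, -⟩ := h
  obtain ⟨p₀⟩ := ‹Nonempty P›
  have key : ∀ (g' : G') (g : G), ∃ k : G, ∀ p : P, g' • g • p = k • g' • p := by
    intro g' g
    have h1 : ∀ p : P, ∃ k : G, k • g' • p₀ = g' • g • p₀ ∧ k • g' • p = g' • g • p := by
      intro p
      have h2 : (proj G (p₀, p) : Gauge G P) = proj G (g • p₀, g • p) :=
        proj_eq_proj_iff.2 ⟨g, rfl⟩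
      have h3 := congrArg (fun a : Gauge G P => g' • a) h2
      simp only [hact] at h3
      obtain ⟨k, hk⟩ := proj_eq_proj_iff.1 h3
      exact ⟨k, congrArg Prod.fst hk, congrArg Prod.snd hk⟩
    choose k hk₀ hk using h1
    refine ⟨k p₀, fun p => ?_⟩
    -- The elements `k p` all have the same value at `g' • p₀`, so freeness removes the dependence
    -- on `p`.
    rw [← hk, smul_left_injective_of_free hfree (g' • p₀) ((hk₀ p).trans (hk₀ p₀).symm)]
  choose C hC using key
  exact ⟨C, hC⟩

lemma DoublePrincipal.IsRelPrincipal.normal_inter [Nonempty P] (h : IsRelPrincipal G G' P)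
    (hfree : ∀ (g : G) (p : P), g • p = p → g = 1) : (inter G' G P).Normal := by
  obtain ⟨_, hact, -, -⟩ := h
  rw [← ker_eq_inter hact hfree]
  infer_instance

/-- Agreement at one point propagates to all of `P`: `g'` fixes the unit `⟨p, p⟩`, and the action on
the groupoid is free modulo its kernel `G₀`. -/
lemma DoublePrincipal.IsRelPrincipal.mem_inter_of_smul_eq [Nonempty P]
    (h : IsRelPrincipal G G' P) (hfree : ∀ (g : G) (p : P), g • p = p → g = 1)
    {g : G} {g' : G'} {p : P} (hp : g • p = g' • p) : g' ∈ inter G' G P := by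
  obtain ⟨_, hact, -, hpre⟩ := h
  let _ := effectiveAction G' (Gauge G P)
  have h1 : (QuotientGroup.mk g' : G' ⧸ (MulAction.toPermHom G' (Gauge G P)).ker) •
      (proj G (p, p) : Gauge G P) = proj G (p, p) := by
    change g' • (proj G (p, p) : Gauge G P) = proj G (p, p)
    rw [hact, ← hp]
    exact proj_smul g (p, p)
  rw [← ker_eq_inter hact hfree]
  exact (QuotientGroup.eq_one_iff g').1 (hpre.free _ _ h1)

/-- The unit map of the gauge groupoid is a closed embedding. -/
lemma exists_isClosedEmbedding_gauge [T2Space P] :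
    ∃ u : MulAction.orbitRel.Quotient G P → Gauge G P, Topology.IsClosedEmbedding u ∧
      ∀ p, u (proj G p) = proj G (p, p) := by
  let u : MulAction.orbitRel.Quotient G P → Gauge G P :=
    Quotient.map' (fun p => (p, p)) (by rintro _ _ ⟨g, rfl⟩; exact ⟨g, rfl⟩)
  have hu : Continuous u := Continuous.quotient_map' (by fun_prop) _
  have ht : Continuous (Gauge.target : Gauge G P → _) := Continuous.quotient_map' continuous_fst _
  have hleft : Function.LeftInverse (Gauge.target : Gauge G P → _) u := by
    rintro ⟨p⟩; rfl
  refine ⟨u, ⟨hleft.isEmbedding ht hu, ?_⟩, fun p => rfl⟩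
  have hq : Topology.IsQuotientMap (proj G : P × P → Gauge G P) := isQuotientMap_quotient_mk'
  rw [← hq.isClosed_preimage]
  -- The preimage of the units in `P × P` is the diagonal, closed because `P` is Hausdorff.
  convert isClosed_diagonal (X := P)
  ext ⟨p, q⟩
  constructor
  · rintro ⟨⟨x⟩, hx⟩
    obtain ⟨g, hg⟩ := proj_eq_proj_iff.1 (show proj G (x, x) = proj G (p, q) from hx)
    exact (congrArg Prod.fst hg).symm.trans (congrArg Prod.snd hg)
  · intro hpq
    obtain rfl : p = q := hpq
    exact ⟨proj G p, rfl⟩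

/-- The induced action of `G'/(G ∩ G')` on the orbit space of `G` is principal. -/
lemma DoublePrincipal.IsRelPrincipal.isPrincipalAction [Nonempty P] [T2Space P]
    (h : IsRelPrincipal G G' P) (hfree : ∀ (g : G) (p : P), g • p = p → g = 1)
    {N : Subgroup G'} [hN : N.Normal] (hNi : N = inter G' G P)
    [MulAction (G' ⧸ N) (MulAction.orbitRel.Quotient G P)]
    (hsmul : ∀ (g' : G') (p : P), (QuotientGroup.mk' N g') • proj G p = proj G (g' • p)) :
    IsPrincipalAction (G' ⧸ N) (MulAction.orbitRel.Quotient G P) := by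
  have h' := h
  obtain ⟨_, hact, -, hpre⟩ := h
  refine ⟨?_, ⟨?_⟩⟩
  · rintro ⟨g'⟩ ⟨p⟩ hp
    have h1 : (QuotientGroup.mk' N g') • proj G p = proj G p := hp
    rw [hsmul] at h1
    obtain ⟨g, hg⟩ := proj_eq_proj_iff.1 h1.symm
    have h2 := h'.mem_inter_of_smul_eq hfree hg
    rw [← hNi] at h2
    exact (QuotientGroup.eq_one_iff g').2 h2
  · rw [← ker_eq_inter hact hfree] at hNi
    subst hNi
    let _ := effectiveAction G' (Gauge G P)
    obtain ⟨u, hu, hup⟩ := exists_isClosedEmbedding_gauge (G := G) (P := P)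
    have hcomm : Prod.map u u ∘ (fun gx : (G' ⧸ (MulAction.toPermHom G' (Gauge G P)).ker) ×
        MulAction.orbitRel.Quotient G P => (gx.1 • gx.2, gx.2)) =
        (fun gx => (gx.1 • gx.2, gx.2)) ∘ Prod.map id u := by
      funext ⟨a, b⟩
      obtain ⟨g', rfl⟩ := QuotientGroup.mk'_surjective _ a
      obtain ⟨p, rfl⟩ := surjective_proj b
      refine Prod.ext ?_ rfl
      change u (QuotientGroup.mk' _ g' • proj G p) = g' • u (proj G p)
      rw [hsmul, hup, hup, hact]
    -- The unit map is equivariant and proper, so after composition with it the action map of the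
    -- orbit space is a restriction of the proper action map of the groupoid. Injectivity of `u`
    -- then allows it to be cancelled.
    have hprop : IsProperMap (Prod.map u u ∘ (fun gx : (G' ⧸
        (MulAction.toPermHom G' (Gauge G P)).ker) × MulAction.orbitRel.Quotient G P =>
          (gx.1 • gx.2, gx.2))) := by
      rw [hcomm]
      exact hpre.proper.isProperMap_smul_pair.comp (isProperMap_id.prodMap hu.isProperMap)
    refine isProperMap_of_comp_of_inj ?_ (hu.continuous.prodMap hu.continuous) hprop
      (hu.injective.prodMap hu.injective)
    exact (hu.isEmbedding.prodMap hu.isEmbedding).continuous_iff.2 hprop.continuous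

end Algebra

/-! ### Lie group structures by descent. -/

section LieGroups

/-- A group with a smooth parametrization in which the group operations are smooth is a Lie
group. -/
lemma HasLocalSections.lieGroup {E H X K : Type*} {r : ℕ} [NormedAddCommGroup E] [NormedSpace ℝ E]
    [TopologicalSpace H] [TopologicalSpace X] [ChartedSpace H X] {I : ModelWithCorners ℝ E H}
    [Group K] [TopologicalSpace K] [ChartedSpace (EuclideanSpace ℝ (Fin r)) K]
    [hK : IsManifold (𝓡 r) ∞ K] {q : X → K} (hq : HasLocalSections I (𝓡 r) q)
    (hs : Function.Surjective q) {μ : X × X → X} (hμ : ContMDiff (I.prod I) I ∞ μ)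
    (hqμ : ∀ x y, q (μ (x, y)) = q x * q y) {ι : X → X} (hι : ContMDiff I I ∞ ι)
    (hqι : ∀ x, q (ι x) = (q x)⁻¹) : LieGroup (𝓡 r) ∞ K where
  toIsManifold := hK
  contMDiff_mul := by
    refine (hq.prodMap hq).contMDiff_of_comp (hs.prodMap hs) ?_
    have : (fun x : X × X => (Prod.map q q x).1 * (Prod.map q q x).2) = fun x => q (μ x) :=
      funext fun x => (hqμ x.1 x.2).symm
    rw [this]
    exact hq.smooth.comp hμ
  contMDiff_inv := by
    refine hq.contMDiff_of_comp hs ?_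
    simp only [← hqι]
    exact hq.smooth.comp hι

end LieGroups

/-! ### The group generated by the two actions. -/

section StructureGroup

variable {G G' P : Type*} [Group G] [Group G'] [MulAction G P] [MulAction G' P]

lemma inclLeft_smul (g : G) (p : P) : inclLeft G G' P g • p = g • p := rfl

lemma inclRight_smul (g' : G') (p : P) : inclRight G G' P g' • p = g' • p := rfl

lemma structureGroup_ext {a b : structureGroup G G' P} (h : ∀ p : P, a • p = b • p) : a = b :=
  Subtype.ext (Equiv.ext h)

/-- The commutation rule `C` moves factors from `G` to the left past `G'`, so the products form a
subgroup. -/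
lemma coe_structureGroup_eq {C : G' → G → G} (hC : ∀ g' g (p : P), g' • g • p = C g' g • g' • p) :
    (structureGroup G G' P : Set (Equiv.Perm P)) =
    {f | ∃ (g : G) (g' : G'), ∀ p, f p = g • g' • p} := by
  let K : Subgroup (Equiv.Perm P) :=
    { carrier := {f | ∃ (g : G) (g' : G'), ∀ p, f p = g • g' • p}
      mul_mem' := by
        rintro a b ⟨g, g', ha⟩ ⟨k, k', hb⟩
        refine ⟨g * C g' k, g' * k', fun p => ?_⟩
        rw [Equiv.Perm.mul_apply, ha, hb, hC, mul_smul, mul_smul]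
      one_mem' := ⟨1, 1, fun p => by simp⟩
      inv_mem' := by
        rintro a ⟨g, g', ha⟩
        refine ⟨C g'⁻¹ g⁻¹, g'⁻¹, fun p => ?_⟩
        rw [← hC, Equiv.Perm.inv_eq_iff_eq, ha, smul_inv_smul, smul_inv_smul] }
  apply Subset.antisymm
  · have : structureGroup G G' P ≤ K := by
      refine sup_le ?_ ?_
      · rintro _ ⟨g, rfl⟩
        exact ⟨g, 1, fun p => by simp⟩
      · rintro _ ⟨g', rfl⟩
        exact ⟨1, g', fun p => by simp⟩
    exact this
  · rintro f ⟨g, g', hf⟩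
    have : f = ((inclLeft G G' P g * inclRight G G' P g' : structureGroup G G' P) :
        Equiv.Perm P) := Equiv.ext hf
    rw [this]
    exact Subtype.property _

end StructureGroup

/-! ### Quotient Lie groups acting on orbit spaces. -/

section InducedAction

variable {n m b : ℕ} {P : Type*} [TopologicalSpace P] [ChartedSpace (EuclideanSpace ℝ (Fin n)) P]
  {K G : Type*} [Group K] [MulAction K P]
  [Group G] [TopologicalSpace G] [ChartedSpace (EuclideanSpace ℝ (Fin m)) G]
  [LieGroup (𝓡 m) ∞ G] [SecondCountableTopology G] [MulAction G P]
  [ChartedSpace (EuclideanSpace ℝ (Fin b)) (MulAction.orbitRel.Quotient K P)]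
  [IsManifold (𝓡 b) ∞ (MulAction.orbitRel.Quotient K P)]
  [T2Space (MulAction.orbitRel.Quotient K P)]

/-- If a smooth action of `G` on `P` induces a free action of `G/N` on the orbit space of another
action, then `G/N` is a Lie group which acts smoothly on the orbit space. -/
theorem exists_lieGroup_quotient [Nonempty P] {N : Subgroup G} [N.Normal]
    (h : ContMDiffSMul (𝓡 m) (𝓡 n) ∞ G P)
    (hs : HasLocalSections (𝓡 n) (𝓡 b) (proj K : P → MulAction.orbitRel.Quotient K P))
    [MulAction (G ⧸ N) (MulAction.orbitRel.Quotient K P)]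
    (hfree : ∀ (g : G ⧸ N) (x : MulAction.orbitRel.Quotient K P), g • x = x → g = 1)
    (hsmul : ∀ (g : G) (p : P), (QuotientGroup.mk' N g) • proj K p = proj K (g • p)) :
    ∃ (r : ℕ) (_ : ChartedSpace (EuclideanSpace ℝ (Fin r)) (G ⧸ N)), IsLie r (G ⧸ N) ∧
      HasLocalSections (𝓡 m) (𝓡 r) (QuotientGroup.mk' N) ∧
      ContMDiffSMul (𝓡 r) (𝓡 b) ∞ (G ⧸ N) (MulAction.orbitRel.Quotient K P) := by
  obtain ⟨p₀⟩ := ‹Nonempty P›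
  have : IsTopologicalGroup G := topologicalGroup_of_lieGroup (𝓡 m) ∞
  -- The orbit map of one class: by freeness of the quotient action its fibres are the cosets of
  -- `N`. It also injects `G ⧸ N` continuously into a Hausdorff space.
  let f : G → MulAction.orbitRel.Quotient K P := fun g => QuotientGroup.mk' N g • proj K p₀
  have hf : ContMDiff (𝓡 m) (𝓡 b) ∞ f := by
    simp only [f, hsmul]
    exact hs.smooth.comp (h.contMDiff_smul_const p₀)
  have hψ : ∀ g : G, ContMDiff (𝓡 b) (𝓡 b) ∞
      fun x : MulAction.orbitRel.Quotient K P => QuotientGroup.mk' N g • x := by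
    intro g
    refine hs.contMDiff_of_comp surjective_proj ?_
    simp only [hsmul]
    exact hs.smooth.comp (h.contMDiff_const_smul' g)
  have hh : IsHomogeneousMap (𝓡 m) (𝓡 b) f := by
    intro a b
    refine ⟨fun g => b * a⁻¹ * g, fun x => QuotientGroup.mk' N (b * a⁻¹)⁻¹ • x,
      contMDiff_mul_left, hψ _, by simp, fun g => ?_⟩
    simp only [f, smul_smul, ← map_mul, inv_mul_cancel_left]
  have hfib : ∀ a b, f a = f b ↔ QuotientGroup.mk' N a = QuotientGroup.mk' N b := fun a b =>
    ⟨fun hab => smul_left_injective_of_free hfree _ hab, fun hab => by simp only [f, hab]⟩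
  have hhom : HasHomogeneousFibers (𝓡 m) (QuotientGroup.mk' N) := by
    intro a b hab
    refine ⟨fun x => x * (a⁻¹ * b), contMDiff_mul_right, by group, fun x => ?_⟩
    rw [map_mul, map_mul, map_inv, hab, inv_mul_cancel, mul_one]
  have hquot : Topology.IsQuotientMap (QuotientGroup.mk' N) := isQuotientMap_quotient_mk'
  obtain ⟨r, cs, hman, hsec⟩ := hh.exists_chartedSpace hf hfib hquot hhom
  have hlie : LieGroup (𝓡 r) ∞ (G ⧸ N) :=
    hsec.lieGroup hquot.surjective (μ := fun x => x.1 * x.2) (contMDiff_mul (𝓡 m) ∞)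
      (fun x y => map_mul _ _ _) (ι := fun x => x⁻¹) (contMDiff_inv (𝓡 m) ∞)
      (fun x => map_inv _ _)
  have hcont : Continuous fun x : G ⧸ N => x • proj K p₀ :=
    hquot.continuous_iff.2 hf.continuous
  refine ⟨r, cs, ⟨hlie, .of_injective_continuous (smul_left_injective_of_free hfree (proj K p₀))
    hcont, hquot.secondCountableTopology (hhom.isOpenMap hquot)⟩, hsec, ⟨?_⟩⟩
  refine (hsec.prodMap hs).contMDiff_of_comp (hquot.surjective.prodMap surjective_proj) ?_
  have : (fun x : G × P => (Prod.map (QuotientGroup.mk' N) (proj K) x).1 •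
      (Prod.map (QuotientGroup.mk' N) (proj K) x).2) = fun x => proj K (x.1 • x.2) :=
    funext fun x => hsmul x.1 x.2
  rw [this]
  exact hs.smooth.comp h.contMDiff_smul

end InducedAction

/-! ### Orbit maps as embeddings and closed Lie subgroups. -/

section OrbitEmbedding

variable {n m : ℕ} {P : Type*} [TopologicalSpace P] [ChartedSpace (EuclideanSpace ℝ (Fin n)) P]
  [IsManifold (𝓡 n) ∞ P] [T2Space P]
  {G : Type*} [Group G] [TopologicalSpace G] [ChartedSpace (EuclideanSpace ℝ (Fin m)) G]
  [LieGroup (𝓡 m) ∞ G] [MulAction G P]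

/-- The orbit maps of a principal action are closed embeddings. -/
lemma DoublePrincipal.IsPrincipalAction.isClosedEmbedding_smul_const {G P : Type*} [Group G]
    [TopologicalSpace G] [TopologicalSpace P] [T1Space P] [MulAction G P]
    (hG : IsPrincipalAction G P) (p : P) : Topology.IsClosedEmbedding fun g : G => g • p := by
  have hmk : Topology.IsClosedEmbedding fun g : G => (g, p) :=
    .of_continuous_injective_isClosedMap (by fun_prop) (fun _ _ hab => congrArg Prod.fst hab)
      (isClosedMap_prodMk_right p)
  have hmk' : Topology.IsEmbedding fun x : P => (x, p) := isEmbedding_prodMkLeft p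
  have hpair : Topology.IsClosedEmbedding fun g : G => (g • p, p) := by
    have h1 : IsProperMap fun g : G => (g • p, p) :=
      hG.proper.isProperMap_smul_pair.comp hmk.isProperMap
    exact .of_continuous_injective_isClosedMap h1.continuous
      (fun a b hab => smul_left_injective_of_free hG.free p (congrArg Prod.fst hab)) h1.isClosedMap
  refine ⟨hmk'.of_comp_iff.1 hpair.isEmbedding, ?_⟩
  convert hpair.isClosed_range.preimage hmk'.continuous
  ext x
  simp

/-- A Lie group with a principal action which factors through a smooth free action of a Lie group
`K` is a closed Lie subgroup of `K`. -/
lemma isClosedNormalLieSubgroup_of_smul_eq [Nonempty P] {k : ℕ} {K : Type*} [Group K]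
    [TopologicalSpace K] [ChartedSpace (EuclideanSpace ℝ (Fin k)) K] [LieGroup (𝓡 k) ∞ K]
    [MulAction K P] (h : ContMDiffSMul (𝓡 m) (𝓡 n) ∞ G P) (hG : IsPrincipalAction G P)
    (hK : ContMDiffSMul (𝓡 k) (𝓡 n) ∞ K P) (hfree : ∀ (a : K) (p : P), a • p = p → a = 1)
    {χ : G →* K} (hχ : ContMDiff (𝓡 m) (𝓡 k) ∞ χ) (hsmul : ∀ g (p : P), χ g • p = g • p)
    (hN : χ.range.Normal) : IsClosedNormalLieSubgroup m k χ := by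
  obtain ⟨p₀⟩ := ‹Nonempty P›
  have hemb := hG.isClosedEmbedding_smul_const p₀
  have hcomp : (fun a : K => a • p₀) ∘ χ = fun g : G => g • p₀ := funext fun g => hsmul g p₀
  have hcont : Continuous fun a : K => a • p₀ := (hK.contMDiff_smul_const p₀).continuous
  refine ⟨⟨isImmersion_of_injective_mderiv hχ fun g => ?_,
    .of_comp hχ.continuous hcont (hcomp ▸ hemb.isEmbedding)⟩, ?_, hN⟩
  · have h1 := injective_mderiv_smul_const h hG.free p₀ g
    rw [← hcomp] at h1
    have h2 := mderiv_comp (f := χ) (x := g)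
      ((hK.contMDiff_smul_const p₀).contMDiffAt.mdifferentiableAt (by simp))
      (hχ.contMDiffAt.mdifferentiableAt (by simp))
    have h3 : Function.Injective (mderiv (𝓡 m) (𝓡 n) (fun y => χ y • p₀) g) := h1
    rw [h2] at h3
    exact Function.Injective.of_comp h3
  · convert hemb.isClosed_range.preimage hcont
    ext a
    constructor
    · rintro ⟨g, rfl⟩
      exact ⟨g, (hsmul g p₀).symm⟩
    · rintro ⟨g, hg⟩
      refine ⟨g, smul_left_injective_of_free hfree p₀ ?_⟩
      exact (hsmul g p₀).trans hg

end OrbitEmbedding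

/-! ### The product map onto the generated group: freeness and normality. -/

section ProductMap

/-- The map `G × G' → Ĝ`. -/
def inclProd (G G' P : Type*) [Group G] [Group G'] [MulAction G P] [MulAction G' P]
    (x : G × G') : structureGroup G G' P :=
  inclLeft G G' P x.1 * inclRight G G' P x.2

variable {G G' P : Type*} [Group G] [Group G'] [MulAction G P] [MulAction G' P]

lemma inclProd_smul (x : G × G') (p : P) : inclProd G G' P x • p = x.1 • x.2 • p := rfl

lemma surjective_inclProd {C : G' → G → G} (hC : ∀ g' g (p : P), g' • g • p = C g' g • g' • p) :
    Function.Surjective (inclProd G G' P) := by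
  intro a
  have ha : (a : Equiv.Perm P) ∈ (structureGroup G G' P : Set (Equiv.Perm P)) := a.2
  rw [coe_structureGroup_eq hC] at ha
  obtain ⟨g, g', h⟩ := ha
  exact ⟨(g, g'), structureGroup_ext fun p => (h p).symm⟩

/-- If `g g'` fixes `p`, then `g⁻¹` and `g'` agree at `p`. So `g'` acts everywhere as an element of
`G`, which must be `g⁻¹` by freeness at `p`. -/
lemma structureGroup_free [Nonempty P] [TopologicalSpace G'] [TopologicalSpace P]
    (h : IsRelPrincipal G G' P) (hfree : ∀ (g : G) (p : P), g • p = p → g = 1)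
    (a : structureGroup G G' P) (p : P) (ha : a • p = p) : a = 1 := by
  obtain ⟨C, hC⟩ := h.exists_conj hfree
  obtain ⟨⟨g, g'⟩, rfl⟩ := surjective_inclProd hC a
  have hp : g⁻¹ • p = g' • p := by
    rw [inv_smul_eq_iff]
    exact ha.symm
  obtain ⟨k, hk⟩ := mem_inter_iff_exists_smul.1 (h.mem_inter_of_smul_eq hfree hp)
  have hkg : k = g⁻¹ := smul_left_injective_of_free hfree p ((hk p).trans hp.symm)
  refine structureGroup_ext fun x => ?_
  rw [inclProd_smul, ← hk, hkg, smul_inv_smul, one_smul]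

lemma normal_range_inclLeft {C : G' → G → G} (hC : ∀ g' g (p : P), g' • g • p = C g' g • g' • p) :
    (inclLeft G G' P).range.Normal := by
  refine ⟨?_⟩
  rintro _ ⟨g, rfl⟩ a
  obtain ⟨⟨k, k'⟩, rfl⟩ := surjective_inclProd hC a
  refine ⟨k * C k' g * k⁻¹, ?_⟩
  rw [eq_mul_inv_iff_mul_eq]
  refine structureGroup_ext fun p => ?_
  simp only [mul_smul, inclProd_smul, inclLeft_smul, inv_smul_smul, hC]

lemma normal_range_inclRight {C : G' → G → G} (hC : ∀ g' g (p : P), g' • g • p = C g' g • g' • p)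
    {C' : G → G' → G'} (hC' : ∀ g g' (p : P), g • g' • p = C' g g' • g • p) :
    (inclRight G G' P).range.Normal := by
  refine ⟨?_⟩
  rintro _ ⟨g', rfl⟩ a
  obtain ⟨⟨k, k'⟩, rfl⟩ := surjective_inclProd hC a
  -- Conjugation by `k'` stays inside `G'`, and `C'` expresses the further conjugation by `k`.
  refine ⟨C' k (k' * g' * k'⁻¹), ?_⟩
  rw [eq_mul_inv_iff_mul_eq]
  refine structureGroup_ext fun p => ?_
  simp only [mul_smul, inclProd_smul, inclRight_smul, inv_smul_smul, ← hC']

end ProductMap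

/-! ### The Lie group structure of the generated group. -/

section StructureGroupLie

variable {n m m' : ℕ} {P : Type*} [TopologicalSpace P] [ChartedSpace (EuclideanSpace ℝ (Fin n)) P]
  [IsManifold (𝓡 n) ∞ P] [T2Space P] [Nonempty P]
  {G : Type*} [Group G] [TopologicalSpace G] [ChartedSpace (EuclideanSpace ℝ (Fin m)) G]
  [LieGroup (𝓡 m) ∞ G] [SecondCountableTopology G]
  {G' : Type*} [Group G'] [TopologicalSpace G'] [ChartedSpace (EuclideanSpace ℝ (Fin m')) G']
  [LieGroup (𝓡 m') ∞ G'] [SecondCountableTopology G']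
  [MulAction G P] [MulAction G' P]

lemma HasLocalSections.id {E H M : Type*} [NormedAddCommGroup E] [NormedSpace ℝ E]
    [TopologicalSpace H] [TopologicalSpace M] [ChartedSpace H M] {I : ModelWithCorners ℝ E H} :
    HasLocalSections I I (id : M → M) :=
  ⟨contMDiff_id, fun _ => ⟨_root_.id, contMDiffAt_id, rfl, .of_forall fun _ => rfl⟩⟩

/-- By freeness the product map has the same fibres as `(g, g') ↦ g g' p₀`. The latter is
homogeneous because the conjugation `C` is smooth, being a division map of the principal `G`-action.
-/
lemma exists_lieGroup_structureGroup (h : ContMDiffSMul (𝓡 m) (𝓡 n) ∞ G P)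
    (h' : ContMDiffSMul (𝓡 m') (𝓡 n) ∞ G' P) (hG : IsPrincipalAction G P)
    (hrel : IsRelPrincipal G G' P) :
    ∃ (k : ℕ) (_ : TopologicalSpace (structureGroup G G' P))
      (_ : ChartedSpace (EuclideanSpace ℝ (Fin k)) (structureGroup G G' P)),
      IsLie k (structureGroup G G' P) ∧
      HasLocalSections ((𝓡 m).prod (𝓡 m')) (𝓡 k) (inclProd G G' P) ∧
      ContMDiffSMul (𝓡 k) (𝓡 n) ∞ (structureGroup G G' P) P := by
  obtain ⟨p₀⟩ := ‹Nonempty P›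
  have hne : Nonempty P := ⟨p₀⟩
  obtain ⟨C, hC⟩ := hrel.exists_conj hG.free
  have hsurj := surjective_inclProd hC
  have hfree := structureGroup_free hrel hG.free
  have hCsmooth : ContMDiff ((𝓡 m').prod (𝓡 m)) (𝓡 m) ∞ fun x : G' × G => C x.1 x.2 := fun x =>
    contMDiffAt_of_smul_eq h hG (a := fun x : G' × G => x.1 • p₀)
      (b := fun x => x.1 • x.2 • p₀)
      ((h'.contMDiff_smul_const p₀).comp contMDiff_fst).contMDiffAt
      (h'.contMDiff_smul.comp (contMDiff_fst.prodMk
        ((h.contMDiff_smul_const p₀).comp contMDiff_snd))).contMDiffAt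
      fun y => (hC _ _ _).symm
  have hCconst : ∀ g', ContMDiff (𝓡 m) (𝓡 m) ∞ (C g') := fun g' =>
    hCsmooth.comp (contMDiff_const.prodMk contMDiff_id)
  have hCone : ∀ g', C g' 1 = 1 := fun g' => hG.free _ (g' • p₀) (by rw [← hC, one_smul])
  let f : G × G' → P := fun x => x.1 • x.2 • p₀
  have hf : ContMDiff ((𝓡 m).prod (𝓡 m')) (𝓡 n) ∞ f :=
    h.contMDiff_smul.comp (contMDiff_fst.prodMk ((h'.contMDiff_smul_const p₀).comp contMDiff_snd))
  have hfib : ∀ a b, f a = f b ↔ inclProd G G' P a = inclProd G G' P b := fun a b =>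
    ⟨fun hab => smul_left_injective_of_free hfree p₀ hab,
      fun hab => congrArg (fun c : structureGroup G G' P => c • p₀) hab⟩
  have hh : IsHomogeneousMap ((𝓡 m).prod (𝓡 m')) (𝓡 n) f := by
    intro a b
    -- This lifts to `G × G'` the left multiplication by `b.1 * (b.2 * a.2⁻¹) * a.1⁻¹` in the
    -- generated group, with `C` restoring the order of the factors; the map on `P` is the inverse
    -- transformation.
    refine ⟨fun x => (b.1 * C (b.2 * a.2⁻¹) (a.1⁻¹ * x.1), b.2 * a.2⁻¹ * x.2),
      fun y => a.1 • (b.2 * a.2⁻¹)⁻¹ • b.1⁻¹ • y, ?_, ?_, ?_, fun x => ?_⟩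
    · exact (contMDiff_mul_left.comp ((hCconst _).comp
        (contMDiff_mul_left.comp contMDiff_fst))).prodMk (contMDiff_mul_left.comp contMDiff_snd)
    · exact (h.contMDiff_const_smul' _).comp ((h'.contMDiff_const_smul' _).comp
        (h.contMDiff_const_smul' _))
    · simp [hCone]
    · simp only [f, mul_smul (b.2 * a.2⁻¹), mul_smul b.1, inv_smul_smul, ← hC]
      rw [mul_smul, smul_inv_smul]
  have hhom : HasHomogeneousFibers ((𝓡 m).prod (𝓡 m')) (inclProd G G' P) := by
    intro a b hab
    -- Since `a` and `b` have the same product, the inserted factors `a.1⁻¹ * b.1` and `b.2 * a.2⁻¹`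
    -- act as mutually inverse transformations.
    refine ⟨fun x => (x.1 * (a.1⁻¹ * b.1), b.2 * a.2⁻¹ * x.2), ?_, by simp, fun x => ?_⟩
    · exact (contMDiff_mul_right.comp contMDiff_fst).prodMk
        (contMDiff_mul_left.comp contMDiff_snd)
    · refine structureGroup_ext fun p => ?_
      have h1 := congrArg (fun c : structureGroup G G' P => c • a.2⁻¹ • x.2 • p) hab
      simp only [inclProd_smul, smul_inv_smul] at h1
      simp only [inclProd_smul, mul_smul, ← h1, inv_smul_smul]
  let _ : TopologicalSpace (structureGroup G G' P) :=
    .coinduced (inclProd G G' P) inferInstance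
  have hquot : Topology.IsQuotientMap (inclProd G G' P) := ⟨⟨rfl⟩, hsurj⟩
  obtain ⟨k, cs, hman, hsec⟩ := hh.exists_chartedSpace hf hfib hquot hhom
  have hlie : LieGroup (𝓡 k) ∞ (structureGroup G G' P) := by
    refine hsec.lieGroup hsurj
      (μ := fun x => (x.1.1 * C x.1.2 x.2.1, x.1.2 * x.2.2)) ?_ (fun x y => ?_)
      (ι := fun x => (C x.2⁻¹ x.1⁻¹, x.2⁻¹)) ?_ (fun x => ?_)
    · have h1 : ContMDiff (((𝓡 m).prod (𝓡 m')).prod ((𝓡 m).prod (𝓡 m'))) (𝓡 m) ∞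
          fun x : (G × G') × (G × G') => C x.1.2 x.2.1 :=
        hCsmooth.comp ((contMDiff_snd.comp contMDiff_fst).prodMk
          (contMDiff_fst.comp contMDiff_snd))
      exact ((contMDiff_fst.comp contMDiff_fst).mul h1).prodMk
        ((contMDiff_snd.comp contMDiff_fst).mul (contMDiff_snd.comp contMDiff_snd))
    · refine structureGroup_ext fun p => ?_
      simp only [inclProd_smul, mul_smul, hC]
    · have h1 : ContMDiff ((𝓡 m).prod (𝓡 m')) (𝓡 m) ∞ fun x : G × G' => C x.2⁻¹ x.1⁻¹ :=
        hCsmooth.comp (contMDiff_snd.inv.prodMk contMDiff_fst.inv)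
      exact h1.prodMk contMDiff_snd.inv
    · rw [eq_inv_iff_mul_eq_one]
      refine structureGroup_ext fun p => ?_
      simp only [inclProd_smul, mul_smul, ← hC, inv_smul_smul, one_smul]
  have hcont : Continuous fun a : structureGroup G G' P => a • p₀ :=
    hquot.continuous_iff.2 hf.continuous
  refine ⟨k, _, cs, ⟨hlie, .of_injective_continuous (smul_left_injective_of_free hfree p₀) hcont,
    hquot.secondCountableTopology (hhom.isOpenMap hquot)⟩, hsec, ⟨?_⟩⟩
  refine (hsec.prodMap (HasLocalSections.id (I := 𝓡 n) (M := P))).contMDiff_of_comp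
    (hsurj.prodMap Function.surjective_id) ?_
  have h1 : ContMDiff (((𝓡 m).prod (𝓡 m')).prod (𝓡 n)) (𝓡 n) ∞
      fun x : (G × G') × P => x.1.2 • x.2 :=
    h'.contMDiff_smul.comp ((contMDiff_snd.comp contMDiff_fst).prodMk contMDiff_snd)
  exact h.contMDiff_smul.comp ((contMDiff_fst.comp contMDiff_fst).prodMk h1)

end StructureGroupLie

/-! ### Properness of the action of the generated group. -/

section Properness

open Filter

variable {G G' P : Type*} [Group G] [Group G'] [MulAction G P] [MulAction G' P]

/-- Changing the `G'`-factor within its coset by `G₀` is compensated in the `G`-factor, since `G₀`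
acts through `G`. -/
lemma exists_inclProd_eq {C : G' → G → G} (hC : ∀ g' g (p : P), g' • g • p = C g' g • g' • p)
    {N : Subgroup G'} [N.Normal] (hN : N = inter G' G P) {g : G} {g' k' : G'}
    (hk : QuotientGroup.mk' N k' = QuotientGroup.mk' N g') :
    ∃ k : G, inclProd G G' P (k, k') = inclProd G G' P (g, g') := by
  have h1 : k'⁻¹ * g' ∈ inter G' G P := by
    rw [← hN]
    exact QuotientGroup.eq.1 hk
  obtain ⟨c, hc⟩ := mem_inter_iff_exists_smul.1 h1
  refine ⟨g * C k' c, structureGroup_ext fun p => ?_⟩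
  simp only [inclProd_smul, mul_smul, ← hC, hc, smul_inv_smul]

variable {m' r : ℕ} [TopologicalSpace G'] [ChartedSpace (EuclideanSpace ℝ (Fin m')) G']
  [TopologicalSpace P] [T2Space P] [TopologicalSpace G]

/-- The group generated by `G` and `G'` acts properly, if `G` does and if `G'/(G ∩ G')` acts
properly on the orbit space of `G`. -/
lemma properSMul_structureGroup {C : G' → G → G}
    (hC : ∀ g' g (p : P), g' • g • p = C g' g • g' • p) [TopologicalSpace (structureGroup G G' P)]
    [ContinuousSMul (structureGroup G G' P) P] [ContinuousSMul G' P]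
    (hcont : Continuous (inclProd G G' P)) [hG : ProperSMul G P]
    {N : Subgroup G'} [N.Normal] (hN : N = inter G' G P)
    [ChartedSpace (EuclideanSpace ℝ (Fin r)) (G' ⧸ N)]
    (hs : HasLocalSections (𝓡 m') (𝓡 r) (QuotientGroup.mk' N))
    [MulAction (G' ⧸ N) (MulAction.orbitRel.Quotient G P)]
    (hsmul : ∀ (g' : G') (p : P), (QuotientGroup.mk' N g') • proj G p = proj G (g' • p))
    [hM : ProperSMul (G' ⧸ N) (MulAction.orbitRel.Quotient G P)] :
    ProperSMul (structureGroup G G' P) P := by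
  have ht2 : T2Space (MulAction.orbitRel.Quotient G P) := t2Space_quotient_mulAction_of_properSMul
  have hproj : Continuous (proj G : P → MulAction.orbitRel.Quotient G P) := continuous_quotient_mk'
  rw [properSMul_iff_continuousSMul_ultrafilter_tendsto_t2]
  refine ⟨inferInstance, fun 𝒰 x₁ x₂ h𝒰 => ?_⟩
  have h₁ : Tendsto (fun y : structureGroup G G' P × P => y.1 • y.2) 𝒰 (𝓝 x₁) :=
    (continuous_fst.tendsto _).comp h𝒰
  have h₂ : Tendsto (fun y : structureGroup G G' P × P => y.2) 𝒰 (𝓝 x₂) :=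
    (continuous_snd.tendsto _).comp h𝒰
  choose s hsec using surjective_inclProd hC
  -- Projecting to the `G`-orbit space removes the `G`-factor, so properness there gives a limit for
  -- the class of the `G'`-factor alone.
  have hstep₁ := (properSMul_iff_continuousSMul_ultrafilter_tendsto_t2.1 hM).2
    (𝒰.map fun y => (QuotientGroup.mk' N (s y.1).2, proj G y.2)) (proj G x₁) (proj G x₂) (by
      rw [Ultrafilter.coe_map, tendsto_map'_iff]
      refine Tendsto.prodMk_nhds ?_ ((hproj.tendsto _).comp h₂)
      refine ((hproj.tendsto _).comp h₁).congr fun y => ?_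
      simp only [Function.comp_apply, hsmul]
      rw [← proj_smul (s y.1).1 ((s y.1).2 • y.2), ← inclProd_smul, hsec])
  obtain ⟨c, hc⟩ := hstep₁
  rw [Ultrafilter.coe_map, tendsto_map'_iff] at hc
  obtain ⟨g', rfl⟩ := QuotientGroup.mk'_surjective N c
  obtain ⟨σ, hσ, hσg, hσev⟩ := hs.exists_section g'
  let β : structureGroup G G' P → G' := fun a => σ (QuotientGroup.mk' N (s a).2)
  have hβ : Tendsto (fun y : structureGroup G G' P × P => β y.1) 𝒰 (𝓝 g') := by
    have := hσ.continuousAt.tendsto.comp hc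
    rwa [hσg] at this
  have hα : ∀ a, ∃ α : G, QuotientGroup.mk' N (β a) = QuotientGroup.mk' N (s a).2 →
      inclProd G G' P (α, β a) = a := by
    intro a
    by_cases ha : QuotientGroup.mk' N (β a) = QuotientGroup.mk' N (s a).2
    · obtain ⟨k, hk⟩ := exists_inclProd_eq hC hN (g := (s a).1) ha
      exact ⟨k, fun _ => hk.trans (hsec a)⟩
    -- A dummy value: along the ultrafilter the section property eventually holds, so this case does
    -- not affect the limit.
    · exact ⟨1, fun h => absurd h ha⟩
  choose α hα using hα
  have hev : ∀ᶠ y in (𝒰 : Filter (structureGroup G G' P × P)),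
      inclProd G G' P (α y.1, β y.1) = y.1 := by
    filter_upwards [hc.eventually hσev] with y hy
    exact hα _ hy
  -- With the `G'`-factor convergent, `β • y.2` converges, and properness of `G` yields a limit of
  -- the `G`-factor.
  have hstep₂ := (properSMul_iff_continuousSMul_ultrafilter_tendsto_t2.1 hG).2
    (𝒰.map fun y => (α y.1, β y.1 • y.2)) x₁ (g' • x₂) (by
      rw [Ultrafilter.coe_map, tendsto_map'_iff]
      refine Tendsto.prodMk_nhds (h₁.congr' ?_) (hβ.smul h₂)
      filter_upwards [hev] with y hy
      exact congrArg (fun a : structureGroup G G' P => a • y.2) hy.symm)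
  obtain ⟨g, hg⟩ := hstep₂
  rw [Ultrafilter.coe_map, tendsto_map'_iff] at hg
  refine ⟨inclProd G G' P (g, g'), ?_⟩
  exact ((hcont.tendsto _).comp (hg.prodMk_nhds hβ)).congr' hev

end Properness

/-! ### The bundles over `M₀` and the orbits of the generated group. -/

section InducedBundle

/-- If the orbits of `K` are the products of the orbits of `G` and `H`, then the projection
`P/H → P/K` is a principal bundle for each quotient of `G` with a principal action on `P/H`. -/
lemma isPrincipalBundle_of_comp_proj {n b c r : ℕ} {P : Type*} [TopologicalSpace P]
    [ChartedSpace (EuclideanSpace ℝ (Fin n)) P] [SecondCountableTopology P]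
    {G H K : Type*} [Group G] [Group H] [Group K] [TopologicalSpace H] [TopologicalSpace G]
    [MulAction G P] [MulAction H P] [MulAction K P] {N : Subgroup G} [N.Normal]
    [ChartedSpace (EuclideanSpace ℝ (Fin r)) (G ⧸ N)]
    [ChartedSpace (EuclideanSpace ℝ (Fin b)) (MulAction.orbitRel.Quotient H P)]
    [ChartedSpace (EuclideanSpace ℝ (Fin c)) (MulAction.orbitRel.Quotient K P)]
    [IsManifold (𝓡 b) ∞ (MulAction.orbitRel.Quotient H P)]
    [MulAction (G ⧸ N) (MulAction.orbitRel.Quotient H P)]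
    {δ : MulAction.orbitRel.Quotient H P → MulAction.orbitRel.Quotient K P}
    (hδ : ∀ p, δ (proj H p) = proj K p)
    (hK : ∀ p q : P, proj K p = proj K q ↔ ∃ (g : G) (h : H), g • h • p = q)
    (hsmul : ∀ (g : G) (p : P), (QuotientGroup.mk' N g) • proj H p = proj H (g • p))
    (hsH : HasLocalSections (𝓡 n) (𝓡 b) (proj H : P → MulAction.orbitRel.Quotient H P))
    (hsK : HasLocalSections (𝓡 n) (𝓡 c) (proj K : P → MulAction.orbitRel.Quotient K P))
    (hL : IsLie r (G ⧸ N)) (hH : IsSmoothManifold b (MulAction.orbitRel.Quotient H P))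
    (hbase : IsSmoothManifold c (MulAction.orbitRel.Quotient K P))
    (hG : ContMDiffSMul (𝓡 r) (𝓡 b) ∞ (G ⧸ N) (MulAction.orbitRel.Quotient H P))
    (hprin : IsPrincipalAction (G ⧸ N) (MulAction.orbitRel.Quotient H P)) :
    ContMDiff (𝓡 b) (𝓡 c) ∞ δ ∧ IsPrincipalBundle r b c (G ⧸ N) δ := by
  have := hbase.isManifold
  have hcomp : (fun p => δ (proj H p)) = (proj K : P → MulAction.orbitRel.Quotient K P) := funext hδ
  have hsm : ContMDiff (𝓡 b) (𝓡 c) ∞ δ :=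
    hsH.contMDiff_of_comp surjective_proj (hcomp ▸ hsK.smooth)
  have hsub : HasLocalSections (𝓡 b) (𝓡 c) δ :=
    .of_comp hsH.smooth surjective_proj hsm (hcomp ▸ hsK)
  refine ⟨hsm, hL, hH, hbase, hG, hprin, ?_, hsub.isSubmersion, fun x y => ?_⟩
  · exact Function.Surjective.of_comp (g := proj H) (by
      change Function.Surjective fun p => δ (proj H p)
      rw [hcomp]
      exact surjective_proj)
  · obtain ⟨p, rfl⟩ := surjective_proj x
    obtain ⟨q, rfl⟩ := surjective_proj y
    rw [hδ, hδ, hK]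
    constructor
    · rintro ⟨g, h, rfl⟩
      refine ⟨QuotientGroup.mk' N g, ?_⟩
      rw [← hsmul, proj_smul]
    · rintro ⟨a, ha⟩
      obtain ⟨g, rfl⟩ := QuotientGroup.mk'_surjective N a
      rw [hsmul] at ha
      obtain ⟨h, rfl⟩ := proj_eq_proj_iff.1 ha
      have h1 : proj K p = proj K (g • p) := (hK _ _).2 ⟨g, 1, by rw [one_smul]⟩
      have h2 : proj K (g • p) = proj K (h • g • p) := (hK _ _).2 ⟨1, h, by rw [one_smul]⟩
      exact (hK _ _).1 (h1.trans h2)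

end InducedBundle

section Orbits

variable {G G' P : Type*} [Group G] [Group G'] [MulAction G P] [MulAction G' P]

lemma proj_structureGroup_eq_iff {C : G' → G → G}
    (hC : ∀ g' g (p : P), g' • g • p = C g' g • g' • p) (p q : P) :
    proj (structureGroup G G' P) p = proj (structureGroup G G' P) q ↔
      ∃ (g : G) (g' : G'), g • g' • p = q := by
  rw [proj_eq_proj_iff]
  constructor
  · rintro ⟨a, rfl⟩
    obtain ⟨x, rfl⟩ := surjective_inclProd hC a
    exact ⟨x.1, x.2, rfl⟩
  · rintro ⟨g, g', rfl⟩
    exact ⟨inclProd G G' P (g, g'), rfl⟩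

lemma proj_structureGroup_eq_iff' {C : G' → G → G}
    (hC : ∀ g' g (p : P), g' • g • p = C g' g • g' • p) (p q : P) :
    proj (structureGroup G G' P) p = proj (structureGroup G G' P) q ↔
      ∃ (g' : G') (g : G), g' • g • p = q := by
  rw [eq_comm, proj_structureGroup_eq_iff hC]
  constructor
  · rintro ⟨g, g', rfl⟩
    exact ⟨g'⁻¹, g⁻¹, by simp⟩
  · rintro ⟨g', g, rfl⟩
    exact ⟨g⁻¹, g'⁻¹, by simp⟩

end Orbits

end

/-! ### Assembly of the double bundle. -/

theorem theorem1 {n m m' : ℕ}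
    (P : Type*) [TopologicalSpace P] [ChartedSpace (EuclideanSpace ℝ (Fin n)) P]
    [IsManifold (𝓡 n) ∞ P] [T2Space P] [SecondCountableTopology P] [Nonempty P]
    (G : Type*) [Group G] [TopologicalSpace G] [ChartedSpace (EuclideanSpace ℝ (Fin m)) G]
    [LieGroup (𝓡 m) ∞ G] [T2Space G] [SecondCountableTopology G]
    (G' : Type*) [Group G'] [TopologicalSpace G'] [ChartedSpace (EuclideanSpace ℝ (Fin m')) G']
    [LieGroup (𝓡 m') ∞ G'] [T2Space G'] [SecondCountableTopology G']
    [MulAction G P] [ContMDiffSMul (𝓡 m) (𝓡 n) ∞ G P]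
    [MulAction G' P] [ContMDiffSMul (𝓡 m') (𝓡 n) ∞ G' P]
    (hP : IsDoublePrincipalBundle G G' P) :
    -- `Ĝ` consists of the products of a transformation from `G` and one from `G'`
    (structureGroup G G' P : Set (Equiv.Perm P)) =
      {f | ∃ (g : G) (g' : G'), ∀ p, f p = g • g' • p} ∧
    -- `G₀` is normal in `G` and in `G'`, so that `[G] = G/G₀` and `[G'] = G'/G₀` are groups
    ∃ (_ : (inter G G' P).Normal) (_ : (inter G' G P).Normal)
      (k r r' b b' c : ℕ)
      -- a topology and smooth charts on `Ĝ`
      (_ : TopologicalSpace (structureGroup G G' P))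
      (_ : ChartedSpace (EuclideanSpace ℝ (Fin k)) (structureGroup G G' P))
      -- smooth charts on `[G]` and `[G']`
      (_ : ChartedSpace (EuclideanSpace ℝ (Fin r)) (G ⧸ inter G G' P))
      (_ : ChartedSpace (EuclideanSpace ℝ (Fin r')) (G' ⧸ inter G' G P))
      -- smooth charts on `M = P/G`, `M' = P/G'` and `M₀ = P/Ĝ`
      (_ : ChartedSpace (EuclideanSpace ℝ (Fin b)) (MulAction.orbitRel.Quotient G P))
      (_ : ChartedSpace (EuclideanSpace ℝ (Fin b')) (MulAction.orbitRel.Quotient G' P))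
      (_ : ChartedSpace (EuclideanSpace ℝ (Fin c))
        (MulAction.orbitRel.Quotient (structureGroup G G' P) P))
      -- actions of `[G]` on `M'` and of `[G']` on `M`
      (_ : MulAction (G ⧸ inter G G' P) (MulAction.orbitRel.Quotient G' P))
      (_ : MulAction (G' ⧸ inter G' G P) (MulAction.orbitRel.Quotient G P)),
      -- `Ĝ` is a Lie group, its structure is the canonical one (the quotient of `G × G'`),
      -- and `G`, `G'` are closed normal Lie subgroups
      IsLie k (structureGroup G G' P) ∧
      Manifold.IsSubmersion ((𝓡 m).prod (𝓡 m')) (𝓡 k) ∞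
        (fun x : G × G' => inclLeft G G' P x.1 * inclRight G G' P x.2) ∧
      IsClosedNormalLieSubgroup m k (inclLeft G G' P) ∧
      IsClosedNormalLieSubgroup m' k (inclRight G G' P) ∧
      -- `[G]` and `[G']` are the quotient Lie groups
      IsLie r (G ⧸ inter G G' P) ∧
      Manifold.IsSubmersion (𝓡 m) (𝓡 r) ∞ (QuotientGroup.mk' (inter G G' P)) ∧
      IsLie r' (G' ⧸ inter G' G P) ∧
      Manifold.IsSubmersion (𝓡 m') (𝓡 r') ∞ (QuotientGroup.mk' (inter G' G P)) ∧
      -- the action of `Ĝ` on `P` is principal, with base `M₀`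
      IsPrincipalBundle k n c (structureGroup G G' P) (proj (structureGroup G G' P) : P → _) ∧
      -- the actions of `[G]` on `M'` and of `[G']` on `M` are the induced ones
      (∀ (g : G) (p : P), (QuotientGroup.mk' (inter G G' P) g) • proj G' p = proj G' (g • p)) ∧
      (∀ (g' : G') (p : P), (QuotientGroup.mk' (inter G' G P) g') • proj G p = proj G (g' • p)) ∧
      -- `P → M` and `P → M'` are principal bundles with groups `G` and `G'`
      IsPrincipalBundle m n b G (proj G : P → _) ∧
      IsPrincipalBundle m' n b' G' (proj G' : P → _) ∧
      -- the actions of `[G]` on `M'` and of `[G']` on `M` are principal, with base `M₀`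
      IsPrincipalBundle r b' c (G ⧸ inter G G' P) (descRight G G' P) ∧
      IsPrincipalBundle r' b c (G' ⧸ inter G' G P) (descLeft G G' P) ∧
      -- the square commutes and consists of morphisms of principal bundles
      (∀ p : P, descLeft G G' P (proj G p) = proj (structureGroup G G' P) p ∧
        descRight G G' P (proj G' p) = proj (structureGroup G G' P) p) ∧
      IsPrincipalBundleMorphism m n b r b' c (proj G) (descRight G G' P)
        (QuotientGroup.mk' (inter G G' P)) (proj G') (descLeft G G' P) ∧
      IsPrincipalBundleMorphism m' n b' r' b c (proj G') (descLeft G G' P)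
        (QuotientGroup.mk' (inter G' G P)) (proj G) (descRight G G' P) := by
  have h : ContMDiffSMul (𝓡 m) (𝓡 n) ∞ G P := inferInstance
  have h' : ContMDiffSMul (𝓡 m') (𝓡 n) ∞ G' P := inferInstance
  have hfree := hP.left.free
  have hfree' := hP.right.free
  have hproper := hP.left.proper
  have hproper' := hP.right.proper
  have hLie : IsLie m G := ⟨inferInstance, inferInstance, inferInstance⟩
  have hLie' : IsLie m' G' := ⟨inferInstance, inferInstance, inferInstance⟩
  obtain ⟨C, hC⟩ := hP.right_rel.exists_conj hfree
  obtain ⟨C', hC'⟩ := hP.left_rel.exists_conj hfree'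
  have hN : (inter G G' P).Normal := hP.left_rel.normal_inter hfree'
  have hN' : (inter G' G P).Normal := hP.right_rel.normal_inter hfree
  -- the orbit spaces of `G` and `G'`
  obtain ⟨b, csM, hM, hsM⟩ := exists_chartedSpace_of_isPrincipalAction h hP.left
  obtain ⟨b', csM', hM', hsM'⟩ := exists_chartedSpace_of_isPrincipalAction h' hP.right
  have hbun := isPrincipalBundle_proj hLie h hP.left hsM
  have hbun' := isPrincipalBundle_proj hLie' h' hP.right hsM'
  have ht2 := hbun.base.t2
  have ht2' := hbun'.base.t2
  -- the induced actions
  obtain ⟨actR, hactR⟩ := exists_mulAction_quotient (N := inter G G' P) hC' fun g hg p => by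
    obtain ⟨g', hg'⟩ := mem_inter_iff_exists_smul.1 hg
    exact ⟨g', hg' p⟩
  obtain ⟨actL, hactL⟩ := exists_mulAction_quotient (N := inter G' G P) hC fun g' hg' p => by
    obtain ⟨g, hg⟩ := mem_inter_iff_exists_smul.1 hg'
    exact ⟨g, hg p⟩
  have hprinR := hP.left_rel.isPrincipalAction hfree' rfl hactR
  have hprinL := hP.right_rel.isPrincipalAction hfree rfl hactL
  obtain ⟨r, csR, hLieR, hsR, hsmR⟩ := exists_lieGroup_quotient h hsM' hprinR.free hactR
  obtain ⟨r', csL, hLieL, hsL, hsmL⟩ := exists_lieGroup_quotient h' hsM hprinL.free hactL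
  have hLieR' := hLieR.lieGroup
  have hLieL' := hLieL.lieGroup
  -- the group generated by `G` and `G'`
  obtain ⟨k, topK, csK, hLieK, hsK, hsmK⟩ :=
    exists_lieGroup_structureGroup h h' hP.left hP.right_rel
  have hLieK' := hLieK.lieGroup
  have hfreeK := structureGroup_free hP.right_rel hfree
  have hcontK : ContinuousSMul (structureGroup G G' P) P := ⟨hsmK.contMDiff_smul.continuous⟩
  have hcont' : ContinuousSMul G' P := ⟨h'.contMDiff_smul.continuous⟩
  have hprinK : IsPrincipalAction (structureGroup G G' P) P := by
    have := hprinL.proper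
    exact ⟨hfreeK, properSMul_structureGroup hC hsK.smooth.continuous rfl hsL hactL⟩
  obtain ⟨c, csM₀, hM₀, hsM₀⟩ := exists_chartedSpace_of_isPrincipalAction hsmK hprinK
  have hbunK := isPrincipalBundle_proj hLieK hsmK hprinK hsM₀
  have hinclL : ContMDiff (𝓡 m) (𝓡 k) ∞ (inclLeft G G' P) := by
    have h1 := hsK.smooth.comp
      ((contMDiff_id (I := 𝓡 m)).prodMk (contMDiff_const (I := 𝓡 m) (I' := 𝓡 m') (c := (1 : G'))))
    exact h1.congr fun g => by simp [inclProd]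
  have hinclR : ContMDiff (𝓡 m') (𝓡 k) ∞ (inclRight G G' P) := by
    have h1 := hsK.smooth.comp
      ((contMDiff_const (I := 𝓡 m') (I' := 𝓡 m) (c := (1 : G))).prodMk (contMDiff_id (I := 𝓡 m')))
    exact h1.congr fun g => by simp [inclProd]
  -- the induced bundles
  obtain ⟨hsmR₀, hbunR⟩ := isPrincipalBundle_of_comp_proj (δ := descRight G G' P) (fun _ => rfl)
    (proj_structureGroup_eq_iff hC) hactR hsM' hsM₀ hLieR hbun'.base hbunK.base hsmR hprinR
  obtain ⟨hsmL₀, hbunL⟩ := isPrincipalBundle_of_comp_proj (δ := descLeft G G' P) (fun _ => rfl)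
    (proj_structureGroup_eq_iff' hC) hactL hsM hsM₀ hLieL hbun.base hbunK.base hsmL hprinL
  exact ⟨coe_structureGroup_eq hC, hN, hN', k, r, r', b, b', c, topK, csK, csR, csL, csM, csM',
    csM₀, actR, actL, hLieK, hsK.isSubmersion,
    isClosedNormalLieSubgroup_of_smul_eq h hP.left hsmK hfreeK hinclL inclLeft_smul
      (normal_range_inclLeft hC),
    isClosedNormalLieSubgroup_of_smul_eq h' hP.right hsmK hfreeK hinclR inclRight_smul
      (normal_range_inclRight hC hC'),
    hLieR, hsR.isSubmersion, hLieL, hsL.isSubmersion, hbunK, hactR, hactL, hbun, hbun', hbunR, hbunL,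
    fun _ => ⟨rfl, rfl⟩,
    ⟨hbun, hbunR, hsR.smooth, hsM'.smooth, hsmL₀, fun g p => (hactR g p).symm, fun _ => rfl⟩,
    ⟨hbun', hbunL, hsL.smooth, hsM.smooth, hsmR₀, fun g p => (hactL g p).symm, fun _ => rfl⟩⟩
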